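/- Let $N$ be a compact, connected smooth ($C^\infty$) surface with nonempty boundary $\partial N$. Then $N$ admits a submersion with definite folds into $\mathbb{R}$, that is, there exists a smooth function $F\colon N\to\mathbb{R}$ such that (i) $dF_p\colon T_pN\to\mathbb{R}$ is surjective for every $p\in N$, including the points $p\in\partial N$; and (ii) the restriction $F|_{\partial N}$ to the closed $1$-manifold $\partial N$ is a definite fold map: for every $p\in\partial N$ at which $d(F|_{\partial N})_p=0$, there are smooth local coordinates $x$ of $\partial N$ around $p$ and $y$ of $\mathbb{R}$ around $F(p)$, centred at these points, in which $F|_{\partial N}$ is written as $x\mapsto y=x^2$ or $x\mapsto y=-x^2$. (Since $\dim\partial N=1$, this says precisely that $F|_{\partial N}$ is a Morse function.) -/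

import Mathlib

open Set Function
open scoped Manifold ContDiff

noncomputable section

/-! ### The boundary of a smooth manifold with boundary, as a smooth manifold -/

/-- The inclusion `y ↦ (0, y)` of `ℝ^m` as the boundary hyperplane of the half-space of
dimension `m + 1` (which consists of the points with first coordinate `≥ 0`). -/
def boundaryIncl {m : ℕ} (y : EuclideanSpace ℝ (Fin m)) : EuclideanHalfSpace (m + 1) :=
  ⟨WithLp.toLp 2 (Fin.cons 0 y), by simp⟩

/-- The projection `(t, y) ↦ y` from `ℝ^(m+1)` to `ℝ^m`. -/
def boundaryProj {m : ℕ} (x : EuclideanSpace ℝ (Fin (m + 1))) : EuclideanSpace ℝ (Fin m) :=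
  WithLp.toLp 2 fun i => x i.succ

lemma boundaryProj_boundaryIncl {m : ℕ} (y : EuclideanSpace ℝ (Fin m)) :
    boundaryProj (boundaryIncl y).1 = y := by
  ext i
  simp [boundaryProj, boundaryIncl]

lemma boundaryIncl_boundaryProj {m : ℕ} {x : EuclideanHalfSpace (m + 1)} (hx : x.1 0 = 0) :
    boundaryIncl (boundaryProj x.1) = x := by
  apply EuclideanHalfSpace.ext
  ext i
  refine Fin.cases ?_ (fun j => ?_) i
  · simp [boundaryIncl, hx]
  · simp [boundaryProj, boundaryIncl]

lemma contDiff_boundaryProj {m : ℕ} : ContDiff ℝ ∞ (boundaryProj (m := m)) := by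
  unfold boundaryProj
  fun_prop

lemma contDiff_boundaryIncl {m : ℕ} :
    ContDiff ℝ ∞ fun y : EuclideanSpace ℝ (Fin m) => (boundaryIncl y).1 := by
  rw [contDiff_euclidean]
  intro i
  refine Fin.cases ?_ (fun j => ?_) i
  · simpa [boundaryIncl] using contDiff_const
  · simp only [boundaryIncl, Fin.cons_succ]
    fun_prop

lemma continuous_boundaryIncl {m : ℕ} : Continuous (boundaryIncl (m := m)) :=
  contDiff_boundaryIncl.continuous.subtype_mk _

section Boundary

variable {m : ℕ} {N : Type*} [TopologicalSpace N] [ChartedSpace (EuclideanHalfSpace (m + 1)) N]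

/-- A point lies on the boundary iff its first coordinate in any chart of the atlas vanishes. -/
lemma mem_boundary_iff_of_mem_atlas [IsManifold (𝓡∂ (m + 1)) ∞ N]
    {e : OpenPartialHomeomorph N (EuclideanHalfSpace (m + 1))}
    (he : e ∈ atlas (EuclideanHalfSpace (m + 1)) N) {x : N} (hx : x ∈ e.source) :
    x ∈ (𝓡∂ (m + 1)).boundary N ↔ (e x).1 0 = 0 := by
  have h1 := ModelWithCorners.isInteriorPoint_iff_of_mem_atlas (I := 𝓡∂ (m + 1)) (n := ∞)
    (by simp) he hx
  have h2 : e.extend (𝓡∂ (m + 1)) x ∈ interior (e.extend (𝓡∂ (m + 1))).target ↔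
      0 < (e x).1 0 := by
    have h3 := interior_range_modelWithCornersEuclideanHalfSpace (m + 1)
    constructor
    · intro h
      have h4 := interior_mono e.extend_target_subset_range h
      rw [h3] at h4
      simpa using h4
    · intro h
      refine e.mem_interior_extend_target (by simp [hx]) ?_
      rw [h3]
      simpa using h
  change (𝓡∂ (m + 1)).IsBoundaryPoint x ↔ _
  rw [ModelWithCorners.isBoundaryPoint_iff_not_isInteriorPoint, h1, h2, not_lt]
  exact ⟨fun h => le_antisymm h (e x).2, fun h => h.le⟩

open Classical in
/-- The chart of the boundary around a boundary point `p`: the restriction to the boundary of the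
preferred chart of `N` around `p`, with the first coordinate (which vanishes on the boundary)
omitted. -/
def boundaryChart [IsManifold (𝓡∂ (m + 1)) ∞ N] (p : (𝓡∂ (m + 1)).boundary N) :
    OpenPartialHomeomorph ((𝓡∂ (m + 1)).boundary N) (EuclideanSpace ℝ (Fin m)) where
  toFun q := boundaryProj (chartAt (EuclideanHalfSpace (m + 1)) p.1 q.1).1
  invFun y :=
    if h : boundaryIncl y ∈ (chartAt (EuclideanHalfSpace (m + 1)) p.1).target then
      ⟨(chartAt (EuclideanHalfSpace (m + 1)) p.1).symm (boundaryIncl y), by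
        rw [mem_boundary_iff_of_mem_atlas (chart_mem_atlas _ p.1)
          ((chartAt (EuclideanHalfSpace (m + 1)) p.1).map_target h),
          (chartAt (EuclideanHalfSpace (m + 1)) p.1).right_inv h]
        simp [boundaryIncl]⟩
    else p
  source := {q | q.1 ∈ (chartAt (EuclideanHalfSpace (m + 1)) p.1).source}
  target := {y | boundaryIncl y ∈ (chartAt (EuclideanHalfSpace (m + 1)) p.1).target}
  map_source' q hq := by
    have h0 := (mem_boundary_iff_of_mem_atlas (chart_mem_atlas _ p.1) hq).1 q.2
    simp only [mem_ofPred_eq]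
    rw [boundaryIncl_boundaryProj h0]
    exact (chartAt (EuclideanHalfSpace (m + 1)) p.1).map_source hq
  map_target' y hy := by
    simp only [mem_ofPred_eq] at hy ⊢
    rw [dif_pos hy]
    exact (chartAt (EuclideanHalfSpace (m + 1)) p.1).map_target hy
  left_inv' q hq := by
    have h0 := (mem_boundary_iff_of_mem_atlas (chart_mem_atlas _ p.1) hq).1 q.2
    have h1 := (chartAt (EuclideanHalfSpace (m + 1)) p.1).map_source hq
    apply Subtype.ext
    simp only [boundaryIncl_boundaryProj h0]
    rw [dif_pos h1]
    exact (chartAt (EuclideanHalfSpace (m + 1)) p.1).left_inv hq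
  right_inv' y hy := by
    simp only [mem_ofPred_eq] at hy
    rw [dif_pos hy, (chartAt (EuclideanHalfSpace (m + 1)) p.1).right_inv hy,
      boundaryProj_boundaryIncl]
  open_source :=
    (chartAt (EuclideanHalfSpace (m + 1)) p.1).open_source.preimage continuous_subtype_val
  open_target :=
    (chartAt (EuclideanHalfSpace (m + 1)) p.1).open_target.preimage continuous_boundaryIncl
  continuousOn_toFun := by
    refine contDiff_boundaryProj.continuous.comp_continuousOn
      (continuous_subtype_val.comp_continuousOn ?_)
    exact (chartAt (EuclideanHalfSpace (m + 1)) p.1).continuousOn.comp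
      continuous_subtype_val.continuousOn fun q hq => hq
  continuousOn_invFun := by
    rw [Topology.IsInducing.subtypeVal.continuousOn_iff]
    refine ContinuousOn.congr
      ((chartAt (EuclideanHalfSpace (m + 1)) p.1).continuousOn_symm.comp
        continuous_boundaryIncl.continuousOn fun y hy => hy) fun y hy => ?_
    simp only [mem_ofPred_eq] at hy
    simp only [comp_apply]
    rw [dif_pos hy]

/-- The boundary of an `(m + 1)`-dimensional smooth manifold with boundary is an
`m`-dimensional manifold, with the charts obtained by restriction. -/
instance boundaryChartedSpace [IsManifold (𝓡∂ (m + 1)) ∞ N] :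
    ChartedSpace (EuclideanSpace ℝ (Fin m)) ((𝓡∂ (m + 1)).boundary N) where
  atlas := range boundaryChart
  chartAt := boundaryChart
  mem_chart_source p := mem_chart_source (EuclideanHalfSpace (m + 1)) p.1
  chart_mem_atlas p := mem_range_self p

/-- The charts of the boundary are smoothly compatible. -/
instance boundaryIsManifold [IsManifold (𝓡∂ (m + 1)) ∞ N] :
    IsManifold (𝓡 m) ∞ ((𝓡∂ (m + 1)).boundary N) := by
  apply isManifold_of_contDiffOn
  rintro _ _ ⟨p, rfl⟩ ⟨q, rfl⟩
  have h := ModelWithCorners.contDiffOn_extendCoordChange (I := 𝓡∂ (m + 1)) (n := ∞)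
    (IsManifold.subset_maximalAtlas (chart_mem_atlas (EuclideanHalfSpace (m + 1)) p.1))
    (IsManifold.subset_maximalAtlas (chart_mem_atlas (EuclideanHalfSpace (m + 1)) q.1))
  have hs : ∀ y : EuclideanSpace ℝ (Fin m),
      (𝓡∂ (m + 1)).symm (boundaryIncl y).1 = boundaryIncl y := fun y =>
    (𝓡∂ (m + 1)).left_inv (boundaryIncl y)
  have key : ∀ y ∈ ((boundaryChart p).symm.trans (boundaryChart q)).source,
      (boundaryIncl y ∈ (chartAt (EuclideanHalfSpace (m + 1)) p.1).target) ∧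
      (chartAt (EuclideanHalfSpace (m + 1)) p.1).symm (boundaryIncl y) ∈
        (chartAt (EuclideanHalfSpace (m + 1)) q.1).source ∧
      ((boundaryChart p).symm y).1 =
        (chartAt (EuclideanHalfSpace (m + 1)) p.1).symm (boundaryIncl y) := by
    rintro y ⟨hy1, hy2⟩
    have hy1' : boundaryIncl y ∈ (chartAt (EuclideanHalfSpace (m + 1)) p.1).target := hy1
    have hval : ((boundaryChart p).symm y).1 =
        (chartAt (EuclideanHalfSpace (m + 1)) p.1).symm (boundaryIncl y) := by
      simp only [boundaryChart, OpenPartialHomeomorph.coe_mk_symm, PartialEquiv.coe_symm_mk]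
      rw [dif_pos hy1']
    refine ⟨hy1', ?_, hval⟩
    rw [← hval]
    exact hy2
  refine ContDiffOn.congr (f := fun y => boundaryProj
    ((𝓡∂ (m + 1)).extendCoordChange (chartAt (EuclideanHalfSpace (m + 1)) p.1)
      (chartAt (EuclideanHalfSpace (m + 1)) q.1) (boundaryIncl y).1))
    (contDiff_boundaryProj.comp_contDiffOn
      (h.comp contDiff_boundaryIncl.contDiffOn ?_)) ?_
  · rintro y ⟨hy, -⟩
    obtain ⟨h1, h2, -⟩ := key y hy
    simp only [ModelWithCorners.extendCoordChange, mem_preimage, PartialEquiv.trans_source,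
      PartialEquiv.symm_source, OpenPartialHomeomorph.extend_target,
      OpenPartialHomeomorph.extend_source, mem_inter_iff,
      OpenPartialHomeomorph.extend_coe_symm, comp_apply, hs]
    exact ⟨⟨h1, mem_range_self (boundaryIncl y)⟩, h2⟩
  · rintro y ⟨hy, -⟩
    obtain ⟨h1, h2, h3⟩ := key y hy
    change boundaryProj (chartAt (EuclideanHalfSpace (m + 1)) q.1
      ((boundaryChart p).symm y).1).1 = _
    rw [h3]
    simp [ModelWithCorners.extendCoordChange, hs]

end Boundary

/-! ### Singular points, submersions, definite folds -/

section Singularities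

variable {E : Type*} [NormedAddCommGroup E] [NormedSpace ℝ E]
  {H : Type*} [TopologicalSpace H] (I : ModelWithCorners ℝ E H)
  {E' : Type*} [NormedAddCommGroup E'] [NormedSpace ℝ E']
  {H' : Type*} [TopologicalSpace H'] (J : ModelWithCorners ℝ E' H')
  {M : Type*} [TopologicalSpace M] [ChartedSpace H M]
  {K : Type*} [TopologicalSpace K] [ChartedSpace H' K]

/-- `p` is a singular point of `f` if the rank of `df_p` is smaller than the dimension of the
target, that is, if `df_p` is not surjective. The manifold `M` may have boundary. -/
def IsSingularPoint (f : M → K) (p : M) : Prop :=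
  ¬ Surjective (mfderiv I J f p)

/-- A submersion is a smooth map without singular points. (The derivative is required to be
surjective on the whole tangent space, also at boundary points; no condition is imposed on the
restriction to the boundary.) -/
def IsSmoothSubmersion (f : M → K) : Prop :=
  ContMDiff I J ∞ f ∧ ∀ p, ¬ IsSingularPoint I J f p

/-- The normal form of a definite fold with sign `σ`:
`(x_1, …, x_m) ↦ (x_1, …, x_{k-1}, σ (x_k ^ 2 + ⋯ + x_m ^ 2))`. -/
def definiteFoldForm {m k : ℕ} (hkm : k ≤ m) (σ : ℤˣ) (x : EuclideanSpace ℝ (Fin m)) :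
    EuclideanSpace ℝ (Fin k) :=
  WithLp.toLp 2 fun j =>
    if j.val + 1 < k then x (Fin.castLE hkm j)
    else ((σ : ℤ) : ℝ) * ∑ i : Fin m with k ≤ i.val + 1, x i ^ 2

/-- `p` is a definite fold point of the map `f` from an `m`-manifold to a `k`-manifold: it is a
singular point, and in suitable smooth local coordinates `φ` of `M` centred at `p` and `ψ` of `K`
centred at `f p`, the map `f` has the definite fold normal form with one of the two signs. -/
def IsDefiniteFoldPoint {m k : ℕ} (hkm : k ≤ m) (f : M → K) (p : M) : Prop :=
  IsSingularPoint I J f p ∧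
  ∃ (φ : PartialDiffeomorph I (𝓡 m) M (EuclideanSpace ℝ (Fin m)) ∞)
    (ψ : PartialDiffeomorph J (𝓡 k) K (EuclideanSpace ℝ (Fin k)) ∞) (σ : ℤˣ),
    p ∈ φ.source ∧ φ p = 0 ∧ f p ∈ ψ.source ∧ ψ (f p) = 0 ∧
    ∀ x ∈ φ.source, f x ∈ ψ.source ∧ ψ (f x) = definiteFoldForm hkm σ (φ x)

/-- A definite fold map from an `m`-manifold to a `k`-manifold: a smooth map all of whose
singular points are definite fold points. -/
def IsDefiniteFoldMap {m k : ℕ} (hkm : k ≤ m) (f : M → K) : Prop :=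
  ContMDiff I J ∞ f ∧ ∀ p, IsSingularPoint I J f p → IsDefiniteFoldPoint I J hkm f p

/-- A submersion with definite folds from an `(m + 1)`-manifold `N` with boundary to a
`k`-manifold `K`, where `m + 1 > k`: a submersion whose restriction to the boundary is a definite
fold map. -/
def IsSubmersionWithDefiniteFolds {m k : ℕ} (hkm : k ≤ m)
    {N : Type*} [TopologicalSpace N] [ChartedSpace (EuclideanHalfSpace (m + 1)) N]
    [IsManifold (𝓡∂ (m + 1)) ∞ N] (F : N → K) : Prop :=
  IsSmoothSubmersion (𝓡∂ (m + 1)) J F ∧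
  IsDefiniteFoldMap (𝓡 m) J hkm (fun p : (𝓡∂ (m + 1)).boundary N => F p)

end Singularities

end

/-! Three steps carry the argument. They have opposite tolerances: the second is global and only
asks for finitely many critical points, the third is an arbitrarily small perturbation.

Generic functions have finitely many critical points. A finite-dimensional linear family of
functions is built from cut-off chart coordinates, so that near each point it contains the linear
functions of some chart (`exists_linear_family`). Adding such functions translates the derivative
arbitrarily, so by Sard and Fubini almost every member has only nondegenerate critical points
(`ae_forall_critical_nondegenerate`). These are isolated, hence finite in number by compactness
(`exists_contMDiff_finite_critical`).

Critical points can be pushed out through the boundary. If `φ : N → N` is a smooth injection with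
surjective derivatives, the critical points of `f ∘ φ` correspond to those critical points of `f`
that lie in the image of `φ`. An inward push at a boundary point misses that point; since `N` is
connected with nonempty boundary, every point is missed by some `φ`
(`exists_isInjectiveSubmersion_notMem_range`). Each composition thus removes a critical point, and
induction ends with a submersion (`exists_submersion_of_finite_critical`).

The restriction to the boundary is made Morse. The same kind of family, built around the boundary,
contains the linear functions of the boundary charts, so almost every perturbation has nondegenerate
critical points on the boundary. Being a submersion is stable under small parameters
(`eventually_forall_mfderiv_ne_zero`), and a set of full measure meets every neighbourhood of `0`.
The one-variable Morse lemma (`exists_partialDiffeomorph_eq_sq`) turns nondegeneracy into the fold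
normal form. -/

noncomputable section

open MeasureTheory Filter Topology

/-! ### Sard's lemma, parametric transversality and generic nondegeneracy. -/

section GenericPerturbation

variable {E V : Type*} [NormedAddCommGroup E] [NormedSpace ℝ E] [FiniteDimensional ℝ E]
  [NormedAddCommGroup V] [NormedSpace ℝ V] [FiniteDimensional ℝ V]
  [MeasurableSpace V] [BorelSpace V] (μ : Measure V) [μ.IsAddHaarMeasure]

/-- Sard's lemma for the equation `f x + e = 0` with parameter `e`. -/
lemma ae_forall_add_eq_zero_imp_det_ne_zero [MeasurableSpace E] [BorelSpace E]
    (ν : Measure E) [ν.IsAddHaarMeasure] {Ω K : Set E}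
    {f : E → E} (hKΩ : K ⊆ Ω) (hf : DifferentiableOn ℝ f Ω) :
    ∀ᵐ e ∂ν, ∀ x ∈ K, f x + e = 0 → (fderivWithin ℝ f Ω x).det ≠ 0 := by
  set s := {x ∈ K | (fderivWithin ℝ f Ω x).det = 0} with hs
  have h0 : ν ((fun x => - f x) '' s) = 0 := by
    refine addHaar_image_eq_zero_of_det_fderivWithin_eq_zero ν
      (f' := fun x => - fderivWithin ℝ f Ω x) (fun x hx => ?_) (fun x hx => ?_)
    · exact (((hf x (hKΩ hx.1)).hasFDerivWithinAt).mono (fun y hy => hKΩ hy.1)).neg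
    · rw [ContinuousLinearMap.det, ContinuousLinearMap.toLinearMap_neg,
        ← neg_one_smul ℝ, LinearMap.det_smul]
      have := hx.2
      rw [ContinuousLinearMap.det] at this
      rw [this, mul_zero]
  filter_upwards [compl_mem_ae_iff.2 h0] with e he x hx hxe hdet
  exact he ⟨x, ⟨hx, hdet⟩, neg_eq_iff_add_eq_zero.2 hxe⟩

omit [MeasurableSpace V] [BorelSpace V] [FiniteDimensional ℝ V] [FiniteDimensional ℝ E] in
lemma fderivWithin_add_clm_apply {F : Type*} [NormedAddCommGroup F] [NormedSpace ℝ F]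
    {Ω : Set E} {x : E} (hU : UniqueDiffWithinAt ℝ Ω x)
    {g : E → F} {w : E → V →L[ℝ] F} (hg : DifferentiableWithinAt ℝ g Ω x)
    (hw : DifferentiableWithinAt ℝ w Ω x) (a : V) :
    fderivWithin ℝ (fun y => g y + w y a) Ω x =
      fderivWithin ℝ g Ω x + (fderivWithin ℝ w Ω x).flip a := by
  have := hg.hasFDerivWithinAt.add
    (hw.hasFDerivWithinAt.clm_apply (hasFDerivWithinAt_const a x Ω))
  have h2 := HasFDerivWithinAt.fderivWithin this hU
  refine Eq.trans h2 ?_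
  ext v
  simp

/-- Parametric transversality: if the affine family `G x + A x a` contains all translations, then
for almost every parameter `a` its zeros in a compact set are nondegenerate. -/
lemma ae_forall_zero_injective_fderivWithin {Ω K : Set E} (hK : IsCompact K) (hKΩ : K ⊆ Ω)
    (hΩ : UniqueDiffOn ℝ Ω) {G : E → E} {A : E → V →L[ℝ] E}
    (hG : ContDiffOn ℝ ∞ G Ω) (hA : ContDiffOn ℝ ∞ A Ω) (L : E →L[ℝ] V)
    (hL : ∀ x ∈ K, ∀ᶠ y in 𝓝[Ω] x, ∀ e, A y (L e) = e) :
    ∀ᵐ a ∂μ, ∀ x ∈ K, G x + A x a = 0 →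
      Injective (fderivWithin ℝ (fun y => G y + A y a) Ω x) := by
  let _ : MeasurableSpace E := borel E
  have : BorelSpace E := ⟨rfl⟩
  have hGd := hG.differentiableOn (by simp)
  have hAd := hA.differentiableOn (by simp)
  set D : E → V → E →L[ℝ] E := fun x a =>
    fderivWithin ℝ G Ω x + (fderivWithin ℝ A Ω x).flip a with hD
  have hDeq : ∀ a, ∀ x ∈ Ω, fderivWithin ℝ (fun y => G y + A y a) Ω x = D x a := fun a x hx =>
    fderivWithin_add_clm_apply (hΩ x hx) (hGd x hx) (hAd x hx) a
  set good : Set V := {a | ∀ x ∈ K, G x + A x a = 0 → (D x a).det ≠ 0} with hgood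
  -- The bad parameters are the projection of a closed subset of `K × V` along the compact factor,
  -- so `good` is open, hence measurable as Fubini requires.
  have hmeas : MeasurableSet good := by
    have hcl : IsClosed {q : K × V | G q.1 + A q.1 q.2 = 0 ∧ (D q.1 q.2).det = 0} := by
      have c1 : Continuous fun q : K × V => G q.1 :=
        ((hG.continuousOn.mono hKΩ).domRestrict).comp continuous_fst
      have c2 : Continuous fun q : K × V => A q.1 :=
        ((hA.continuousOn.mono hKΩ).domRestrict).comp continuous_fst
      have c3 : Continuous fun q : K × V => fderivWithin ℝ G Ω q.1 :=
        (((hG.continuousOn_fderivWithin hΩ (by simp)).mono hKΩ).domRestrict).comp continuous_fst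
      have c4 : Continuous fun q : K × V => fderivWithin ℝ A Ω q.1 :=
        (((hA.continuousOn_fderivWithin hΩ (by simp)).mono hKΩ).domRestrict).comp continuous_fst
      have c5 : Continuous fun q : K × V => (fderivWithin ℝ A Ω q.1).flip q.2 := by
        have c6 : Continuous fun q : K × V => (fderivWithin ℝ A Ω q.1).flip :=
          (ContinuousLinearMap.flipₗᵢ ℝ E V E).continuous.comp c4
        exact c6.clm_apply continuous_snd
      refine (isClosed_eq (c1.add (c2.clm_apply continuous_snd)) continuous_const).inter
        (isClosed_eq ?_ continuous_const)
      exact ContinuousLinearMap.continuous_det.comp (c3.add c5)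
    have : CompactSpace K := isCompact_iff_compactSpace.1 hK
    have h2 := isClosedMap_snd_of_compactSpace _ hcl
    have h3 : good = (Prod.snd '' {q : K × V | G q.1 + A q.1 q.2 = 0 ∧ (D q.1 q.2).det = 0})ᶜ := by
      ext a
      simp only [hgood, mem_ofPred_eq, mem_compl_iff, mem_image, Prod.exists, not_exists]
      constructor
      · rintro h x b ⟨⟨h1, h2⟩, rfl⟩
        exact h x x.2 h1 h2
      · intro h x hx h1 h2
        exact h ⟨x, hx⟩ a ⟨⟨h1, h2⟩, rfl⟩
    rw [h3]
    exact h2.measurableSet.compl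
  -- By Fubini it is enough that, for each `b`, the parameter `b + L e` is good for almost every
  -- `e`. Near a point of `K` it gives the map for `b` plus the constant `e`, which has the same
  -- derivative, so Sard applies.
  have hae : ∀ᵐ a ∂μ, a ∈ good := by
    refine ae_mem_of_ae_add_linearMap_mem (L : E →ₗ[ℝ] V) (Measure.addHaar) μ hmeas fun b => ?_
    have hfd : DifferentiableOn ℝ (fun y => G y + A y b) Ω :=
      hGd.add (hAd.clm_apply (differentiableOn_const b))
    filter_upwards [ae_forall_add_eq_zero_imp_det_ne_zero Measure.addHaar hKΩ hfd]
      with e he x hx hzero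
    have hev : (fun y => G y + A y (b + L e)) =ᶠ[𝓝[Ω] x] fun y => (G y + A y b) + e := by
      filter_upwards [hL x hx] with y hy
      rw [map_add, hy e, add_assoc]
    have hx' := hev.self_of_nhdsWithin (hKΩ hx)
    have h1 := he x hx (hx'.symm.trans hzero)
    have h2 : D x (b + L e) = fderivWithin ℝ (fun y => G y + A y b) Ω x := by
      rw [← hDeq _ x (hKΩ hx), hev.fderivWithin_eq hx', fderivWithin_add_const]
    change (D x (b + L e)).det ≠ 0
    rwa [h2]
  filter_upwards [hae] with a ha x hx hzero
  rw [hDeq a x (hKΩ hx)]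
  exact (LinearMap.equivOfDetNeZero (D x a : E →ₗ[ℝ] E) (ha x hx hzero)).injective

omit [MeasurableSpace V] [BorelSpace V] [FiniteDimensional ℝ V] in
lemma finrank_strongDual : Module.finrank ℝ (E →L[ℝ] ℝ) = Module.finrank ℝ E := by
  rw [← (LinearMap.toContinuousLinearMap (𝕜 := ℝ) (E := E) (F' := ℝ)).finrank_eq]
  exact Subspace.dual_finrank_eq

/-- In a linear family of functions containing all linear functions, the critical points in a
compact set of almost every member are nondegenerate. -/
lemma ae_forall_critical_nondegenerate {Ω K : Set E} (hK : IsCompact K) (hKΩ : K ⊆ Ω)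
    (hΩ : UniqueDiffOn ℝ Ω) {g : E → ℝ} {w : E → V →L[ℝ] ℝ}
    (hg : ContDiffOn ℝ ∞ g Ω) (hw : ContDiffOn ℝ ∞ w Ω) (L : (E →L[ℝ] ℝ) →L[ℝ] V)
    (hL : ∀ x ∈ K, ∀ᶠ y in 𝓝[Ω] x, ∀ l, w y (L l) = l y) :
    ∀ᵐ a ∂μ, ∀ x ∈ K, fderivWithin ℝ (fun y => g y + w y a) Ω x = 0 →
      Injective (fderivWithin ℝ (fderivWithin ℝ (fun y => g y + w y a) Ω) Ω x) := by
  -- The transversality lemma concerns maps from `E` to itself, so the derivative, valued in the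
  -- dual, is transported to `E` by an arbitrary linear isomorphism.
  let T : (E →L[ℝ] ℝ) ≃L[ℝ] E := ContinuousLinearEquiv.ofFinrankEq finrank_strongDual
  have hgd := hg.differentiableOn (by simp)
  have hwd := hw.differentiableOn (by simp)
  have hg1 : ContDiffOn ℝ ∞ (fderivWithin ℝ g Ω) Ω := hg.fderivWithin hΩ (by simp)
  have hw1 : ContDiffOn ℝ ∞ (fderivWithin ℝ w Ω) Ω := hw.fderivWithin hΩ (by simp)
  have hDeq : ∀ a, ∀ x ∈ Ω, fderivWithin ℝ (fun y => g y + w y a) Ω x =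
      fderivWithin ℝ g Ω x + (fderivWithin ℝ w Ω x).flip a := fun a x hx =>
    fderivWithin_add_clm_apply (hΩ x hx) (hgd x hx) (hwd x hx) a
  have hG : ContDiffOn ℝ ∞ (fun x => T (fderivWithin ℝ g Ω x)) Ω :=
    T.contDiff.comp_contDiffOn hg1
  have hA : ContDiffOn ℝ ∞ (fun x => (T : (E →L[ℝ] ℝ) →L[ℝ] E).comp
      (fderivWithin ℝ w Ω x).flip) Ω := by
    refine ContDiffOn.clm_comp contDiffOn_const ?_
    have hflip : ContDiff ℝ ∞ fun f : E →L[ℝ] V →L[ℝ] ℝ => f.flip :=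
      IsBoundedLinearMap.contDiff (IsLinearMap.with_bound
        ⟨ContinuousLinearMap.flip_add, ContinuousLinearMap.flip_smul⟩ 1
        fun f => by rw [ContinuousLinearMap.opNorm_flip, one_mul])
    exact hflip.comp_contDiffOn hw1
  have key := ae_forall_zero_injective_fderivWithin μ hK hKΩ hΩ hG hA
    (L.comp (T.symm : E →L[ℝ] (E →L[ℝ] ℝ))) (fun x hx => by
      -- The double "eventually" provides the identity `w z (L l) = l z` for `z` near `y`, so that
      -- it can be differentiated at `y`: a linear function has constant derivative, and all
      -- translations occur.
      filter_upwards [eventually_eventually_nhdsWithin.2 (hL x hx), self_mem_nhdsWithin]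
        with y hy hyΩ e
      have h1 := hDeq (L (T.symm e)) y hyΩ
      have h2 : fderivWithin ℝ (fun y => w y (L (T.symm e))) Ω y = T.symm e := by
        have h3 : (fun y => w y (L (T.symm e))) =ᶠ[𝓝[Ω] y] fun y => T.symm e y := by
          filter_upwards [hy] with z hz using hz _
        rw [h3.fderivWithin_eq (h3.self_of_nhdsWithin hyΩ)]
        exact (T.symm e).hasFDerivWithinAt.fderivWithin (hΩ y hyΩ)
      have h4 : (fderivWithin ℝ w Ω y).flip (L (T.symm e)) = T.symm e := by
        refine Eq.trans ?_ h2
        have := fderivWithin_add_clm_apply (g := fun _ => (0 : ℝ)) (hΩ y hyΩ)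
          (differentiableWithinAt_const 0) (hwd y hyΩ) (L (T.symm e))
        simpa using this.symm
      simp [h4])
  filter_upwards [key] with a ha x hx hcrit
  have h1 := ha x hx (by
    have := hDeq a x (hKΩ hx)
    rw [hcrit] at this
    simp only [ContinuousLinearMap.comp_apply, ContinuousLinearEquiv.coe_coe]
    rw [← map_add, ← this, map_zero])
  have h2 : fderivWithin ℝ (fun y => T (fderivWithin ℝ g Ω y) +
      ((T : (E →L[ℝ] ℝ) →L[ℝ] E).comp (fderivWithin ℝ w Ω y).flip) a) Ω x =
      (T : (E →L[ℝ] ℝ) →L[ℝ] E).comp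
        (fderivWithin ℝ (fderivWithin ℝ (fun y => g y + w y a) Ω) Ω x) := by
    rw [← T.comp_fderivWithin (hΩ x (hKΩ hx))]
    refine fderivWithin_congr (fun y hy => ?_) ?_
    · simp [hDeq a y hy]
    · simp [hDeq a x (hKΩ hx)]
  rw [h2] at h1
  exact Injective.of_comp (f := T) h1

end GenericPerturbation

/-! ### Hadamard's lemma and the Morse lemma in one variable. -/

section MorseLemma

/-- The weight `u` makes this class of integrals stable under differentiation, which replaces `(u,
f)` by `(u t * t, deriv f)`. This is what lets the induction in `contDiff_integral_mul_comp_mul`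
close. -/
lemma hasDerivAt_integral_mul_comp_mul {u f : ℝ → ℝ} (hu : Continuous u) (hf : ContDiff ℝ ∞ f)
    (x : ℝ) : HasDerivAt (fun x => ∫ t in (0:ℝ)..1, u t * f (t * x))
      (∫ t in (0:ℝ)..1, (u t * t) * deriv f (t * x)) x := by
  have hf' : Continuous (deriv f) := hf.continuous_deriv (by simp)
  have hc : Continuous fun p : ℝ × ℝ => (u p.2 * p.2) * deriv f (p.2 * p.1) := by fun_prop
  obtain ⟨C, hC⟩ := ((isCompact_closedBall x 1).prod (isCompact_Icc (a := (0:ℝ)) (b := 1))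
    ).exists_bound_of_continuousOn hc.continuousOn
  have hfc := hf.continuous
  refine (intervalIntegral.hasDerivAt_integral_of_dominated_loc_of_deriv_le
    (s := Metric.closedBall x 1) (bound := fun _ => C)
    (F := fun x t => u t * f (t * x)) (F' := fun x t => (u t * t) * deriv f (t * x))
    (Metric.closedBall_mem_nhds x one_pos) ?_ ?_ ?_ ?_ ?_ ?_).2
  · exact Eventually.of_forall fun y => by
      apply Continuous.aestronglyMeasurable
      fun_prop
  · apply Continuous.intervalIntegrable
    fun_prop
  · apply Continuous.aestronglyMeasurable
    fun_prop
  · refine Eventually.of_forall fun t ht y hy => hC (y, t) ⟨hy, ?_⟩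
    rw [uIoc_of_le zero_le_one] at ht
    exact ⟨ht.1.le, ht.2⟩
  · exact intervalIntegrable_const
  · refine Eventually.of_forall fun t ht y hy => ?_
    have h1 : HasDerivAt f (deriv f (t * y)) (t * y) :=
      (hf.differentiable (by simp) _).hasDerivAt
    have h2 := (h1.comp y ((hasDerivAt_id y).const_mul t)).const_mul (u t)
    refine h2.congr_deriv ?_
    ring

lemma contDiff_integral_mul_comp_mul {u f : ℝ → ℝ} (hu : Continuous u) (hf : ContDiff ℝ ∞ f) :
    ContDiff ℝ ∞ (fun x => ∫ t in (0:ℝ)..1, u t * f (t * x)) := by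
  rw [contDiff_infty]
  intro n
  induction n generalizing u f with
  | zero =>
    exact contDiff_zero.2 (continuous_iff_continuousAt.2 fun x =>
      (hasDerivAt_integral_mul_comp_mul hu hf x).continuousAt)
  | succ n ih =>
    rw [Nat.cast_add, Nat.cast_one, contDiff_succ_iff_deriv]
    refine ⟨fun x => (hasDerivAt_integral_mul_comp_mul hu hf x).differentiableAt, by simp, ?_⟩
    have : deriv (fun x => ∫ t in (0:ℝ)..1, u t * f (t * x)) =
        fun x => ∫ t in (0:ℝ)..1, (u t * t) * deriv f (t * x) :=
      funext fun x => (hasDerivAt_integral_mul_comp_mul hu hf x).deriv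
    rw [this]
    exact ih (u := fun t => u t * t) (by fun_prop) ((contDiff_infty_iff_deriv.1 hf).2)

/-- Hadamard's lemma. -/
lemma ContDiff.exists_eq_mul_of_map_zero {f : ℝ → ℝ} (hf : ContDiff ℝ ∞ f) (h0 : f 0 = 0) :
    ∃ k : ℝ → ℝ, ContDiff ℝ ∞ k ∧ ∀ x, f x = x * k x := by
  refine ⟨fun x => ∫ t in (0:ℝ)..1, 1 * deriv f (t * x), contDiff_integral_mul_comp_mul
    continuous_const (contDiff_infty_iff_deriv.1 hf).2, fun x => ?_⟩
  have hf' : Continuous (deriv f) := hf.continuous_deriv (by simp)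
  have h := intervalIntegral.integral_eq_sub_of_hasDerivAt (a := 0) (b := 1)
    (f := fun t => f (t * x)) (f' := fun t => x * deriv f (t * x)) (fun t _ => by
      have h1 : HasDerivAt f (deriv f (t * x)) (t * x) :=
        (hf.differentiable (by simp) _).hasDerivAt
      refine (h1.comp t ((hasDerivAt_id t).mul_const x)).congr_deriv ?_
      ring) (by
      apply Continuous.intervalIntegrable
      fun_prop)
  rw [intervalIntegral.integral_const_mul] at h
  simpa [h0] using h.symm

/-- Hadamard's lemma is applied twice: `f = x * k`, where `k 0 = f' 0 = 0`, and then `k = x * h`.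
Since `f'' 0 = 2 * k' 0 = 2 * h 0`, the factor `h` does not vanish at `0`. -/
lemma ContDiff.exists_eq_sq_mul {f : ℝ → ℝ} (hf : ContDiff ℝ ∞ f) (h0 : f 0 = 0)
    (h1 : deriv f 0 = 0) (h2 : deriv (deriv f) 0 ≠ 0) :
    ∃ h : ℝ → ℝ, ContDiff ℝ ∞ h ∧ (∀ x, f x = x ^ 2 * h x) ∧ h 0 ≠ 0 := by
  obtain ⟨k, hk, hfk⟩ := hf.exists_eq_mul_of_map_zero h0
  have hdk : ∀ x, deriv f x = k x + x * deriv k x := fun x => by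
    have : HasDerivAt k (deriv k x) x := (hk.differentiable (by simp) _).hasDerivAt
    rw [funext hfk]
    simpa using ((hasDerivAt_id' x).fun_mul this).deriv
  have hk0 : k 0 = 0 := by simpa [h1] using (hdk 0).symm
  obtain ⟨h, hh, hkh⟩ := hk.exists_eq_mul_of_map_zero hk0
  refine ⟨h, hh, fun x => by rw [hfk, hkh]; ring, fun hh0 => h2 ?_⟩
  have hk'0 : deriv k 0 = 0 := by
    have : HasDerivAt h (deriv h 0) 0 := (hh.differentiable (by simp) _).hasDerivAt
    rw [funext hkh]
    simpa [hh0] using ((hasDerivAt_id' (0:ℝ)).fun_mul this).deriv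
  have hk2 : Differentiable ℝ (deriv k) :=
    (contDiff_infty_iff_deriv.1 hk).2.differentiable (by simp)
  have a1 : HasDerivAt k (deriv k 0) 0 := (hk.differentiable (by simp) _).hasDerivAt
  have a2 : HasDerivAt (deriv k) (deriv (deriv k) 0) 0 := (hk2 _).hasDerivAt
  rw [funext hdk]
  simpa [hk'0] using (a1.fun_add ((hasDerivAt_id' (0:ℝ)).fun_mul a2)).deriv

/-- The inverse function theorem in one variable, as a partial diffeomorphism. -/
lemma exists_partialDiffeomorph_of_deriv_ne_zero {θ : ℝ → ℝ} {U : Set ℝ} (hU : IsOpen U)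
    {x₀ : ℝ} (hx₀ : x₀ ∈ U) (hθ : ContDiffOn ℝ ∞ θ U) (hd : deriv θ x₀ ≠ 0) :
    ∃ Φ : PartialDiffeomorph 𝓘(ℝ, ℝ) 𝓘(ℝ, ℝ) ℝ ℝ ∞,
      x₀ ∈ Φ.source ∧ Φ.source ⊆ U ∧ ∀ x, Φ x = θ x := by
  have hder : ContinuousOn (deriv θ) U := hθ.continuousOn_deriv_of_isOpen hU (by simp)
  have hW : IsOpen (U ∩ deriv θ ⁻¹' {0}ᶜ) := hder.isOpen_inter_preimage hU isOpen_compl_singleton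
  have hfd : ∀ x ∈ U ∩ deriv θ ⁻¹' {0}ᶜ, ∃ d : ℝ ≃L[ℝ] ℝ, HasFDerivAt θ (d : ℝ →L[ℝ] ℝ) x := by
    rintro x ⟨hxU, hx⟩
    have h1 : HasDerivAt θ (deriv θ x) x :=
      ((hθ.contDiffAt (hU.mem_nhds hxU)).differentiableAt (by simp)).hasDerivAt
    exact ⟨ContinuousLinearEquiv.unitsEquivAut ℝ (Units.mk0 _ hx),
      h1.hasFDerivAt_equiv hx⟩
  obtain ⟨d, hd'⟩ := hfd x₀ ⟨hx₀, hd⟩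
  have hx₀' := hθ.contDiffAt (hU.mem_nhds hx₀)
  -- The restriction to the locus where the derivative is nonzero makes the inverse smooth on the
  -- whole target, not only at the image of `x₀`.
  let e := (hx₀'.toOpenPartialHomeomorph θ hd' (by simp)).restrOpen _ hW
  have hesub : e.source ⊆ U ∩ deriv θ ⁻¹' {0}ᶜ := by
    intro x hx
    rw [OpenPartialHomeomorph.restrOpen_source] at hx
    exact hx.2
  refine ⟨{ toPartialEquiv := e.toPartialEquiv
            open_source := e.open_source
            open_target := e.open_target
            contMDiffOn_toFun := ?_
            contMDiffOn_invFun := ?_ }, ?_, ?_, ?_⟩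
  · exact contMDiffOn_iff_contDiffOn.2 (hθ.mono fun x hx => (hesub hx).1)
  · refine contMDiffOn_iff_contDiffOn.2 fun y hy => ?_
    have hy' := e.map_target hy
    obtain ⟨d', hd''⟩ := hfd _ (hesub hy')
    exact (e.contDiffAt_symm hy hd''
      (hθ.contDiffAt (hU.mem_nhds (hesub hy').1))).contDiffWithinAt
  · change x₀ ∈ e.source
    rw [OpenPartialHomeomorph.restrOpen_source]
    exact ⟨hx₀'.mem_toOpenPartialHomeomorph_source hd' (by simp), hx₀, hd⟩
  · exact fun x hx => (hesub hx).1
  · intro x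
    rfl

/-- The Morse lemma in one variable. -/
lemma exists_partialDiffeomorph_eq_sq {g : ℝ → ℝ} {U : Set ℝ} (hU : IsOpen U)
    {x₀ : ℝ} (hx₀ : x₀ ∈ U) (hg : ContDiffOn ℝ ∞ g U) (h1 : deriv g x₀ = 0)
    (h2 : deriv (deriv g) x₀ ≠ 0) :
    ∃ (Φ : PartialDiffeomorph 𝓘(ℝ, ℝ) 𝓘(ℝ, ℝ) ℝ ℝ ∞) (σ : ℤˣ),
      x₀ ∈ Φ.source ∧ Φ.source ⊆ U ∧ Φ x₀ = 0 ∧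
      ∀ x ∈ Φ.source, g x = g x₀ + ((σ : ℤ) : ℝ) * Φ x ^ 2 := by
  obtain ⟨ε, hε, hεU⟩ := Metric.isOpen_iff.1 hU x₀ hx₀
  -- Hadamard's lemma is stated for globally smooth functions, so `g - g x₀` is cut off. It is
  -- unchanged on the ball of radius `ε / 4`, which contains the domain of the final coordinate.
  let β : ContDiffBump x₀ := ⟨ε / 4, ε / 2, by positivity, by linarith⟩
  have hβU : tsupport β ⊆ U := by
    rw [β.tsupport_eq]
    exact (Metric.closedBall_subset_ball (by simp [β]; linarith)).trans hεU
  have hG1 : ContDiff ℝ ∞ fun x => β x * (g x - g x₀) := by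
    rw [contDiff_iff_contDiffAt]
    intro x
    by_cases hx : x ∈ tsupport β
    · exact β.contDiff.contDiffAt.mul
        ((hg.contDiffAt (hU.mem_nhds (hβU hx))).sub contDiffAt_const)
    · refine (contDiffAt_const (c := (0:ℝ))).congr_of_eventuallyEq ?_
      filter_upwards [notMem_tsupport_iff_eventuallyEq.1 hx] with y hy
      simp [hy]
  have hG1e : (fun x => β x * (g x - g x₀)) =ᶠ[𝓝 x₀] fun x => g x - g x₀ := by
    filter_upwards [β.eventuallyEq_one] with x hx
    simp [hx]
  let G : ℝ → ℝ := fun x => (fun x => β x * (g x - g x₀)) (x + x₀)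
  have hG : ContDiff ℝ ∞ G := hG1.comp (contDiff_id.add contDiff_const)
  have hG0 : G 0 = 0 := by simp [G]
  have hdG : deriv G = fun x => deriv (fun x => β x * (g x - g x₀)) (x + x₀) :=
    funext fun x => deriv_comp_add_const (fun x => β x * (g x - g x₀)) x₀ x
  have hG10 : deriv G 0 = 0 := by
    rw [hdG]
    simp only [zero_add]
    rw [hG1e.deriv_eq, deriv_sub_const, h1]
  have hG20 : deriv (deriv G) 0 ≠ 0 := by
    rw [hdG, deriv_comp_add_const (deriv fun x => β x * (g x - g x₀)) x₀ 0, zero_add,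
      hG1e.deriv.deriv_eq]
    have : (deriv fun x => g x - g x₀) = deriv g := funext fun x => deriv_sub_const _
    rwa [this]
  obtain ⟨h, hh, hGh, hh0⟩ := hG.exists_eq_sq_mul hG0 hG10 hG20
  obtain ⟨σ, hσ⟩ : ∃ σ : ℤˣ, 0 < ((σ : ℤ) : ℝ) * h 0 := by
    rcases hh0.lt_or_gt with hneg | hpos
    · exact ⟨-1, by simpa using hneg⟩
    · exact ⟨1, by simpa using hpos⟩
  have hσ2 : ((σ : ℤ) : ℝ) * ((σ : ℤ) : ℝ) = 1 := by
    rcases Int.units_eq_one_or σ with rfl | rfl <;> simp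
  let q : ℝ → ℝ := fun x => ((σ : ℤ) : ℝ) * h (x - x₀)
  have hq : ContDiff ℝ ∞ q := contDiff_const.mul (hh.comp (contDiff_id.sub contDiff_const))
  have hq0 : 0 < q x₀ := by simpa [q] using hσ
  let W : Set ℝ := Metric.ball x₀ (ε / 4) ∩ q ⁻¹' Ioi 0
  have hW : IsOpen W := Metric.isOpen_ball.inter (isOpen_Ioi.preimage hq.continuous)
  have hx₀W : x₀ ∈ W := ⟨Metric.mem_ball_self (by positivity), hq0⟩
  -- The Morse coordinate: `σ * θ ^ 2` equals `(x - x₀) ^ 2 * h (x - x₀)` wherever `q` is positive.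
  let θ : ℝ → ℝ := fun x => (x - x₀) * Real.sqrt (q x)
  have hsq : ContDiffOn ℝ ∞ (fun x => Real.sqrt (q x)) W :=
    hq.contDiffOn.sqrt fun x hx => (hx.2 : 0 < q x).ne'
  have hθ : ContDiffOn ℝ ∞ θ W := (contDiff_id.sub contDiff_const).contDiffOn.mul hsq
  have hdθ : deriv θ x₀ ≠ 0 := by
    have a1 : HasDerivAt (fun x => Real.sqrt (q x)) (deriv (fun x => Real.sqrt (q x)) x₀) x₀ :=
      ((hsq.contDiffAt (hW.mem_nhds hx₀W)).differentiableAt (by simp)).hasDerivAt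
    have a2 := (((hasDerivAt_id x₀).sub_const x₀).mul a1).deriv
    have a3 : deriv θ x₀ = Real.sqrt (q x₀) := by
      refine Eq.trans a2 ?_
      simp
    rw [a3]
    exact (Real.sqrt_pos.2 hq0).ne'
  obtain ⟨Φ, hΦ1, hΦ2, hΦ3⟩ := exists_partialDiffeomorph_of_deriv_ne_zero hW hx₀W hθ hdθ
  refine ⟨Φ, σ, hΦ1, fun x hx => hεU ?_, by simp [hΦ3, θ], fun x hx => ?_⟩
  · exact Metric.ball_subset_ball (by linarith) (hΦ2 hx).1
  · obtain ⟨hxb, hxq⟩ := hΦ2 hx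
    have b1 : β x = 1 := β.one_of_mem_closedBall (Metric.ball_subset_closedBall hxb)
    have b2 := hGh (x - x₀)
    simp only [G, sub_add_cancel, b1, one_mul] at b2
    rw [hΦ3 x]
    simp only [θ]
    rw [mul_pow, Real.sq_sqrt (le_of_lt hxq)]
    simp only [q]
    linear_combination b2 - (x - x₀) ^ 2 * h (x - x₀) * hσ2

end MorseLemma

/-! ### Cut-off translations of a vector space. -/

section BumpTranslation

variable {E : Type*} [NormedAddCommGroup E] [NormedSpace ℝ E] [FiniteDimensional ℝ E]

/-- Small translations, cut off by a bump function, are diffeomorphisms. -/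
lemma ContDiffBump.exists_forall_add_smul_injective {x₀ : E} (β : ContDiffBump x₀) :
    ∃ δ > 0, ∀ v : E, ‖v‖ < δ → Injective (fun x => x + β x • v) ∧
      ∀ x, Surjective (fderiv ℝ (fun x => x + β x • v) x) := by
  obtain ⟨C, hC⟩ := ContDiff.lipschitzWith_of_hasCompactSupport (n := 1) (𝕂 := ℝ)
    β.hasCompactSupport β.contDiff (by simp)
  have hC0 : (0:ℝ) ≤ C := C.2
  -- This bound makes `x ↦ β x • v` Lipschitz with constant `C * ‖v‖ < 1`. A perturbation of the
  -- identity by such a map is injective, and so is its derivative.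
  refine ⟨1 / (C + 1), by positivity, fun v hv => ?_⟩
  have hCv : C * ‖v‖ < 1 := by
    rw [lt_div_iff₀ (by positivity)] at hv
    nlinarith [norm_nonneg v]
  have hzero : ∀ u : E, ‖u‖ ≤ C * ‖v‖ * ‖u‖ → u = 0 := fun u hu => by
    by_contra h
    have := norm_pos_iff.2 h
    nlinarith
  refine ⟨fun x y hxy => ?_, fun x => ?_⟩
  · simp only at hxy
    refine sub_eq_zero.1 (hzero _ ?_)
    have h1 : x - y = (β y - β x) • v := by
      rw [sub_smul, sub_eq_sub_iff_add_eq_add, hxy, add_comm]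
    have h2 := hC.dist_le_mul y x
    rw [dist_eq_norm, dist_eq_norm] at h2
    calc ‖x - y‖ = ‖β y - β x‖ * ‖v‖ := by rw [← norm_smul, ← h1]
      _ ≤ (C * ‖y - x‖) * ‖v‖ := by gcongr
      _ = C * ‖v‖ * ‖x - y‖ := by rw [norm_sub_rev]; ring
  · have hβ : HasFDerivAt β (fderiv ℝ β x) x :=
      (β.contDiff (n := 1).differentiable (by simp) x).hasFDerivAt
    have hd : fderiv ℝ (fun x => x + β x • v) x =
        ContinuousLinearMap.id ℝ E + (fderiv ℝ β x).smulRight v :=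
      ((hasFDerivAt_id x).add (hβ.smul_const v)).fderiv
    rw [hd]
    refine (LinearMap.injective_iff_surjective (f :=
      ((ContinuousLinearMap.id ℝ E + (fderiv ℝ β x).smulRight v : E →L[ℝ] E) : E →ₗ[ℝ] E))).1 ?_
    refine (injective_iff_map_eq_zero _).2 fun u hu => hzero u ?_
    have hu' : u + fderiv ℝ β x u • v = 0 := by simpa using hu
    have h3 : ‖fderiv ℝ β x u‖ ≤ C * ‖u‖ :=
      (ContinuousLinearMap.le_opNorm _ _).trans
        (by gcongr; exact norm_fderiv_le_of_lipschitz ℝ hC)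
    calc ‖u‖ = ‖fderiv ℝ β x u‖ * ‖v‖ := by
          rw [eq_neg_of_add_eq_zero_left hu', norm_neg, norm_smul, ← eq_neg_of_add_eq_zero_left hu']
      _ ≤ (C * ‖u‖) * ‖v‖ := by gcongr
      _ = C * ‖v‖ * ‖u‖ := by ring

end BumpTranslation

/-! ### Injective submersions of a manifold into itself. -/

section InjectiveSubmersion

variable {E : Type*} [NormedAddCommGroup E] [NormedSpace ℝ E]
  {H : Type*} [TopologicalSpace H] (I : ModelWithCorners ℝ E H)
  {N : Type*} [TopologicalSpace N] [ChartedSpace H N]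

/-- A smooth injective self-map of a manifold with surjective derivatives, such as an isotopy of
a manifold with boundary into itself. -/
structure IsInjectiveSubmersion (φ : N → N) : Prop where
  contMDiff : ContMDiff I I ∞ φ
  injective : Injective φ
  surjective_mfderiv : ∀ p, Surjective (mfderiv I I φ p)

variable {I}

lemma IsInjectiveSubmersion.comp {φ χ : N → N} (hφ : IsInjectiveSubmersion I φ)
    (hχ : IsInjectiveSubmersion I χ) : IsInjectiveSubmersion I (φ ∘ χ) where
  contMDiff := hφ.contMDiff.comp hχ.contMDiff
  injective := hφ.injective.comp hχ.injective
  surjective_mfderiv p := by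
    rw [mfderiv_comp p (hφ.contMDiff.mdifferentiableAt (by simp))
      (hχ.contMDiff.mdifferentiableAt (by simp))]
    exact (hφ.surjective_mfderiv _).comp (hχ.surjective_mfderiv p)

open Classical in
/-- A self-map of a chart domain which is the identity off a compact set extends by the identity. -/
lemma exists_isInjectiveSubmersion_of_chart [T2Space N] [IsManifold I ∞ N] (c : N) {K : Set E}
    (hK : IsCompact K) (hKt : K ⊆ (extChartAt I c).target) {ψ : E → E} (hψ : ContDiff ℝ ∞ ψ)
    (hψinj : Injective ψ) (hψd : ∀ x, Surjective (fderiv ℝ ψ x)) [FiniteDimensional ℝ E]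
    (hψK : MapsTo ψ K (extChartAt I c).target)
    (hψid : ∀ x ∈ (extChartAt I c).target, x ∉ K → ψ x = x) :
    ∃ φ : N → N, IsInjectiveSubmersion I φ ∧
      (∀ p ∈ (extChartAt I c).source, φ p ∈ (extChartAt I c).source ∧
        extChartAt I c (φ p) = ψ (extChartAt I c p)) ∧
      ∀ p ∉ (extChartAt I c).source, φ p = p := by
  set e := extChartAt I c with he
  have hψt : MapsTo ψ e.target e.target := fun x hx => by
    by_cases hxK : x ∈ K
    · exact hψK hxK
    · rwa [hψid x hx hxK]
  have hopen : IsOpen e.source := isOpen_extChartAt_source c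
  let φ : N → N := fun p => if p ∈ e.source then e.symm (ψ (e p)) else p
  have h1 : ∀ p ∈ e.source, φ p = e.symm (ψ (e p)) := fun p hp => if_pos hp
  have h2 : ∀ p ∉ e.source, φ p = p := fun p hp => if_neg hp
  have hmem : ∀ p ∈ e.source, φ p ∈ e.source := fun p hp => by
    rw [h1 p hp]
    exact e.map_target (hψt (e.map_source hp))
  have heφ : ∀ p ∈ e.source, e (φ p) = ψ (e p) := fun p hp => by
    rw [h1 p hp]
    exact e.right_inv (hψt (e.map_source hp))
  -- A compact subset of a Hausdorff space is closed, so `φ` is the identity on a neighbourhood of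
  -- each point outside the chart domain. Smoothness there follows.
  have hC : IsClosed (e.symm '' K) :=
    (hK.image_of_continuousOn ((continuousOn_extChartAt_symm c).mono hKt)).isClosed
  have hid : ∀ p ∉ e.symm '' K, φ p = p := fun p hp => by
    by_cases hps : p ∈ e.source
    · rw [h1 p hps, hψid _ (e.map_source hps), e.left_inv hps]
      exact fun h => hp ⟨_, h, e.left_inv hps⟩
    · exact h2 p hps
  have hidev : ∀ p ∉ e.source, φ =ᶠ[𝓝 p] id := fun p hp => by
    have : p ∉ e.symm '' K := by
      rintro ⟨x, hx, rfl⟩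
      exact hp (e.map_target (hKt hx))
    filter_upwards [hC.isOpen_compl.mem_nhds this] with q hq using hid q hq
  have hsm : ContMDiff I I ∞ φ := fun p => by
    by_cases hp : p ∈ e.source
    · have ha : ContMDiffOn I 𝓘(ℝ, E) ∞ e e.source := by
        have := contMDiffOn_extChartAt (I := I) (x := c) (n := ∞)
        rwa [← extChartAt_source I] at this
      have hb : ContMDiffOn 𝓘(ℝ, E) I ∞ e.symm e.target := contMDiffOn_extChartAt_symm c
      have hc : ContMDiffOn I I ∞ (fun p => e.symm (ψ (e p))) e.source :=
        hb.comp (hψ.contMDiff.comp_contMDiffOn ha) fun q hq => hψt (e.map_source hq)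
      exact ((hc p hp).contMDiffAt (hopen.mem_nhds hp)).congr_of_eventuallyEq
        (by filter_upwards [hopen.mem_nhds hp] with q hq using h1 q hq)
    · exact contMDiffAt_id.congr_of_eventuallyEq (hidev p hp)
  refine ⟨φ, ⟨hsm, fun p q hpq => ?_, fun p => ?_⟩, fun p hp => ⟨hmem p hp, heφ p hp⟩, h2⟩
  · by_cases hp : p ∈ e.source <;> by_cases hq : q ∈ e.source
    · refine e.injOn hp hq (hψinj ?_)
      rw [← heφ p hp, ← heφ q hq, hpq]
    · exact absurd (by rw [← h2 q hq, ← hpq]; exact hmem p hp) hq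
    · exact absurd (by rw [← h2 p hp, hpq]; exact hmem q hq) hp
    · rw [← h2 p hp, hpq, h2 q hq]
  · by_cases hp : p ∈ e.source
    · have hedc : ∀ q ∈ e.source, MDifferentiableAt I 𝓘(ℝ, E) e q := fun q hq =>
        mdifferentiableAt_extChartAt (by rwa [he, extChartAt_source] at hq)
      have hev : e ∘ φ =ᶠ[𝓝 p] ψ ∘ e := by
        filter_upwards [hopen.mem_nhds hp] with q hq using heφ q hq
      have hd := hev.mfderiv_eq (I := I) (I' := 𝓘(ℝ, E))
      rw [mfderiv_comp p (hedc _ (hmem p hp)) (hsm.mdifferentiableAt (by simp)),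
        mfderiv_comp p (hψ.contMDiff.mdifferentiableAt (by simp)) (hedc p hp)] at hd
      have i1 := isInvertible_mfderiv_extChartAt (I := I) (x := c) (hmem p hp)
      have i2 := isInvertible_mfderiv_extChartAt (I := I) (x := c) hp
      intro w
      obtain ⟨z, hz⟩ := hψd (e p) (mfderiv I 𝓘(ℝ, E) e (φ p) w)
      obtain ⟨u, rfl⟩ := i2.bijective.2 z
      refine ⟨u, i1.bijective.1 ?_⟩
      have := DFunLike.congr_fun hd u
      rw [mfderiv_eq_fderiv] at this
      exact this.trans hz
    · rw [(hidev p hp).mfderiv_eq]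
      intro w
      exact ⟨w, by rw [mfderiv_id]; rfl⟩

end InjectiveSubmersion

/-! ### Pushing critical points out of the manifold. -/

section PushOff

/-- Points near an interior point can be moved to it. -/
lemma eventually_exists_isInjectiveSubmersion_eq
    {E : Type*} [NormedAddCommGroup E] [NormedSpace ℝ E] [FiniteDimensional ℝ E]
    {H : Type*} [TopologicalSpace H] {I : ModelWithCorners ℝ E H}
    {N : Type*} [TopologicalSpace N] [ChartedSpace H N] [T2Space N] [IsManifold I ∞ N]
    {p : N} (hp : I.IsInteriorPoint p) :
    ∀ᶠ q in 𝓝 p, ∃ φ : N → N, IsInjectiveSubmersion I φ ∧ φ q = p := by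
  set e := extChartAt I p with he
  obtain ⟨R, hR, hRt⟩ := Metric.mem_nhds_iff.1 (show e.target ∈ 𝓝 (e p) by
    have := extChartAt_target_mem_nhdsWithin (I := I) p
    rwa [nhdsWithin_eq_nhds.2 (range_mem_nhds_isInteriorPoint hp)] at this)
  let β : ContDiffBump (e p) := ⟨R / 4, R / 2, by positivity, by linarith⟩
  obtain ⟨δ, hδ, hβ⟩ := β.exists_forall_add_smul_injective
  have hcont : ContinuousAt e p := continuousAt_extChartAt p
  have hr : 0 < min δ (R / 4) := by positivity
  filter_upwards [hcont.preimage_mem_nhds (Metric.ball_mem_nhds _ hr),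
    extChartAt_source_mem_nhds (I := I) p] with q hq hqs
  have hq' : ‖e p - e q‖ < min δ (R / 4) := by
    rw [← dist_eq_norm, dist_comm]
    exact hq
  have hqδ := hq'.trans_le (min_le_left _ _)
  have hqR := hq'.trans_le (min_le_right _ _)
  obtain ⟨hinj, hsurj⟩ := hβ (e p - e q) hqδ
  obtain ⟨φ, hφ, h1, -⟩ := exists_isInjectiveSubmersion_of_chart (I := I) p
    (isCompact_closedBall (e p) (R / 2))
    ((Metric.closedBall_subset_ball (by linarith)).trans hRt)
    (ψ := fun x => x + β x • (e p - e q))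
    (contDiff_id.add (β.contDiff.smul contDiff_const)) hinj hsurj
    (fun x hx => hRt (by
      rw [Metric.mem_ball, dist_eq_norm, add_sub_right_comm]
      have hx' : ‖x - e p‖ ≤ R / 2 := by rw [← dist_eq_norm]; exact hx
      have : ‖β x • (e p - e q)‖ ≤ ‖e p - e q‖ := by
        rw [norm_smul, Real.norm_of_nonneg β.nonneg]
        exact mul_le_of_le_one_left (norm_nonneg _) β.le_one
      linarith [norm_add_le (x - e p) (β x • (e p - e q))]))
    (fun x _ hx => by
      rw [β.zero_of_le_dist (le_of_lt (not_le.1 hx)), zero_smul, add_zero])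
  refine ⟨φ, hφ, ?_⟩
  have hβq : β (e q) = 1 := β.one_of_mem_closedBall (by
    rw [Metric.mem_closedBall, dist_comm, dist_eq_norm]
    exact hqR.le)
  obtain ⟨hφs, hφe⟩ := h1 q hqs
  refine e.injOn hφs (mem_extChartAt_source p) (hφe.trans ?_)
  change e q + β (e q) • (e p - e q) = e p
  rw [hβq, one_smul, add_sub_cancel]

variable {m : ℕ} {N : Type*} [TopologicalSpace N] [T2Space N]
  [ChartedSpace (EuclideanHalfSpace (m + 1)) N] [IsManifold (𝓡∂ (m + 1)) ∞ N]

/-- The manifold can be pushed inwards off a boundary point. -/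
lemma exists_isInjectiveSubmersion_notMem_range_of_mem_boundary {p : N}
    (hp : p ∈ (𝓡∂ (m + 1)).boundary N) :
    ∃ φ : N → N, IsInjectiveSubmersion (𝓡∂ (m + 1)) φ ∧ p ∉ range φ := by
  set e := extChartAt (𝓡∂ (m + 1)) p with he
  have hp0 : e p 0 = 0 := (mem_boundary_iff_of_mem_atlas (chart_mem_atlas _ p)
    (mem_chart_source _ p)).1 hp
  have hrange : range (𝓡∂ (m + 1)) = {y | 0 ≤ y 0} := range_modelWithCornersEuclideanHalfSpace _
  obtain ⟨R, hR, hRt⟩ := Metric.mem_nhdsWithin_iff.1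
    (extChartAt_target_mem_nhdsWithin (I := 𝓡∂ (m + 1)) p)
  let β : ContDiffBump (e p) := ⟨R / 4, R / 2, by positivity, by linarith⟩
  obtain ⟨δ, hδ, hβ⟩ := β.exists_forall_add_smul_injective
  -- The length `s` is below `δ`, for injectivity, and below `R / 2`, so that the support of the
  -- bump stays within the ball of radius `R`.
  set s := min δ (R / 2) / 2 with hs
  have hs0 : 0 < s := by positivity
  set v : EuclideanSpace ℝ (Fin (m + 1)) := EuclideanSpace.single 0 s with hv
  have hvn : ‖v‖ = s := by simp [hv, abs_of_pos hs0]
  have hsδ : s < δ := (half_lt_self (by positivity)).trans_le (min_le_left _ _)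
  have hsR : s < R / 2 := (half_lt_self (by positivity)).trans_le (min_le_right _ _)
  obtain ⟨hinj, hsurj⟩ := hβ v (by rwa [hvn])
  have hψ0 : ∀ x, (x + β x • v) 0 = x 0 + β x * s := fun x => by simp [hv]
  obtain ⟨φ, hφ, h1, h2⟩ := exists_isInjectiveSubmersion_of_chart (I := 𝓡∂ (m + 1)) p
    -- The push increases the first coordinate, so it preserves the half-space; it need not be onto
    -- it, which is the point of the construction.
    ((isCompact_closedBall (e p) (R / 2)).inter_right (𝓡∂ (m + 1)).isClosed_range)
    ((inter_subset_inter_left _ (Metric.closedBall_subset_ball (by linarith))).trans hRt)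
    (ψ := fun x => x + β x • v)
    (contDiff_id.add (β.contDiff.smul contDiff_const)) hinj hsurj
    (fun x hx => hRt ⟨by
      rw [Metric.mem_ball, dist_eq_norm, add_sub_right_comm]
      have hx' : ‖x - e p‖ ≤ R / 2 := by rw [← dist_eq_norm]; exact hx.1
      have : ‖β x • v‖ ≤ ‖v‖ := by
        rw [norm_smul, Real.norm_of_nonneg β.nonneg]
        exact mul_le_of_le_one_left (norm_nonneg _) β.le_one
      linarith [norm_add_le (x - e p) (β x • v)], by
      have hx2 := hx.2
      rw [hrange] at hx2 ⊢
      change 0 ≤ (x + β x • v) 0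
      rw [hψ0]
      exact add_nonneg hx2 (mul_nonneg β.nonneg hs0.le)⟩)
    (fun x hxt hx => by
      have hx' : x ∉ Metric.closedBall (e p) (R / 2) := fun h =>
        hx ⟨h, extChartAt_target_subset_range p hxt⟩
      rw [β.zero_of_le_dist (le_of_lt (not_le.1 hx')), zero_smul, add_zero])
  refine ⟨φ, hφ, ?_⟩
  rintro ⟨q, hq⟩
  by_cases hqs : q ∈ e.source
  · have hqt := e.map_source hqs
    have heq : e q + β (e q) • v = e p := by
      rw [← (h1 q hqs).2, hq]
    -- In the first coordinate, two nonnegative terms sum to `0`. Hence `β (e q) = 0`, so `e q = e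
    -- p`, where `β` equals `1`.
    have h4 := hψ0 (e q)
    rw [heq, hp0] at h4
    have hq0 : 0 ≤ e q 0 := by
      have := extChartAt_target_subset_range p hqt
      rwa [hrange] at this
    have hβ0 : β (e q) = 0 := by
      have := mul_nonneg (β.nonneg (x := e q)) hs0.le
      have h5 : β (e q) * s = 0 := by linarith
      exact (mul_eq_zero.1 h5).resolve_right hs0.ne'
    rw [hβ0, zero_smul, add_zero] at heq
    rw [heq, β.one_of_mem_closedBall (Metric.mem_closedBall_self (by positivity))] at hβ0
    exact one_ne_zero hβ0
  · rw [h2 q hqs] at hq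
    exact hqs (hq ▸ mem_extChartAt_source p)

/-- Connectedness argument on the set of points that can be missed. It is open because images are
compact. It is closed because it contains the boundary, while near an interior limit point `p` some
missable `q` can be moved to `p`: if `χ` misses `q` and the injective `φ` sends `q` to `p`, then `φ
∘ χ` misses `p`. -/
lemma exists_isInjectiveSubmersion_notMem_range [CompactSpace N] [ConnectedSpace N]
    (hN : ((𝓡∂ (m + 1)).boundary N).Nonempty) (p : N) :
    ∃ φ : N → N, IsInjectiveSubmersion (𝓡∂ (m + 1)) φ ∧ p ∉ range φ := by
  set S : Set N := {p | ∃ φ : N → N, IsInjectiveSubmersion (𝓡∂ (m + 1)) φ ∧ p ∉ range φ} with hS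
  have hSo : IsOpen S := by
    rw [isOpen_iff_mem_nhds]
    rintro p ⟨φ, hφ, hp⟩
    have hc : IsClosed (range φ) := (isCompact_range hφ.contMDiff.continuous).isClosed
    filter_upwards [hc.isOpen_compl.mem_nhds hp] with q hq using ⟨φ, hφ, hq⟩
  have hSc : IsClosed S := by
    rw [← closure_subset_iff_isClosed]
    intro p hp
    rcases (𝓡∂ (m + 1)).isInteriorPoint_or_isBoundaryPoint p with hint | hbd
    · obtain ⟨q, ⟨χ, hχ, hχq⟩, φ, hφ, hφq⟩ := mem_closure_iff_frequently.1 hp |>.and_eventually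
        (eventually_exists_isInjectiveSubmersion_eq hint) |>.exists
      refine ⟨φ ∘ χ, hφ.comp hχ, ?_⟩
      rintro ⟨r, hr⟩
      exact hχq ⟨r, hφ.injective (hr.trans hφq.symm)⟩
    · exact exists_isInjectiveSubmersion_notMem_range_of_mem_boundary hbd
  have hSn : S.Nonempty := by
    obtain ⟨p, hp⟩ := hN
    exact ⟨p, exists_isInjectiveSubmersion_notMem_range_of_mem_boundary hp⟩
  have hSu : S = univ := IsClopen.eq_univ ⟨hSc, hSo⟩ hSn
  have : p ∈ S := hSu ▸ mem_univ p
  exact this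

/-- A smooth function with finitely many critical points can be replaced by one without critical
points. -/
lemma exists_submersion_of_finite_critical [CompactSpace N] [ConnectedSpace N]
    (hN : ((𝓡∂ (m + 1)).boundary N).Nonempty) {f : N → ℝ}
    (hf : ContMDiff (𝓡∂ (m + 1)) 𝓘(ℝ, ℝ) ∞ f)
    (hfin : {p | mfderiv (𝓡∂ (m + 1)) 𝓘(ℝ, ℝ) f p = 0}.Finite) :
    ∃ F : N → ℝ, ContMDiff (𝓡∂ (m + 1)) 𝓘(ℝ, ℝ) ∞ F ∧
      ∀ p, mfderiv (𝓡∂ (m + 1)) 𝓘(ℝ, ℝ) F p ≠ 0 := by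
  induction hk : {p | mfderiv (𝓡∂ (m + 1)) 𝓘(ℝ, ℝ) f p = 0}.ncard using Nat.strong_induction_on
    generalizing f with
  | _ k ih =>
    rcases eq_empty_or_nonempty {p | mfderiv (𝓡∂ (m + 1)) 𝓘(ℝ, ℝ) f p = 0} with hem | ⟨p, hp⟩
    · exact ⟨f, hf, fun p hp => (hem ▸ (show p ∈ {p | _} from hp) : p ∈ (∅ : Set N))⟩
    · obtain ⟨φ, hφ, hpφ⟩ := exists_isInjectiveSubmersion_notMem_range hN p
      have hcrit : {q | mfderiv (𝓡∂ (m + 1)) 𝓘(ℝ, ℝ) (f ∘ φ) q = 0} =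
          φ ⁻¹' {q | mfderiv (𝓡∂ (m + 1)) 𝓘(ℝ, ℝ) f q = 0} := by
        ext q
        change _ = 0 ↔ _ = 0
        rw [mfderiv_comp q (hf.mdifferentiableAt (by simp))
          (hφ.contMDiff.mdifferentiableAt (by simp))]
        constructor
        · intro h
          ext w
          obtain ⟨u, rfl⟩ := hφ.surjective_mfderiv q w
          exact DFunLike.congr_fun h u
        · intro h
          rw [h]
          exact ContinuousLinearMap.zero_comp _
      -- The new critical set injects into the old one and misses `p`, so its cardinality drops.
      have himg : φ '' (φ ⁻¹' {q | mfderiv (𝓡∂ (m + 1)) 𝓘(ℝ, ℝ) f q = 0}) ⊂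
          {q | mfderiv (𝓡∂ (m + 1)) 𝓘(ℝ, ℝ) f q = 0} := by
        refine (image_preimage_subset _ _).ssubset_of_mem_notMem hp ?_
        rintro ⟨q, -, hq⟩
        exact hpφ ⟨q, hq⟩
      refine ih _ ?_ (hf.comp hφ.contMDiff) ?_ rfl
      · rw [hcrit, ← hk, ← ncard_image_of_injective _ hφ.injective]
        exact ncard_lt_ncard himg hfin
      · rw [hcrit]
        exact hfin.preimage hφ.injective.injOn

end PushOff

/-! ### Linear families of functions, finiteness of critical points, stability of submersions. -/

section Families

variable {E : Type*} [NormedAddCommGroup E] [NormedSpace ℝ E]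
  {H : Type*} [TopologicalSpace H] {I : ModelWithCorners ℝ E H}
  {N : Type*} [TopologicalSpace N] [ChartedSpace H N] [IsManifold I ∞ N]
  {G : Type*} [NormedAddCommGroup G] [NormedSpace ℝ G]

lemma ContMDiff.contDiffOn_comp_extChartAt_symm {f : N → G} (hf : ContMDiff I 𝓘(ℝ, G) ∞ f)
    (c : N) : ContDiffOn ℝ ∞ (fun x => f ((extChartAt I c).symm x)) (extChartAt I c).target :=
  (hf.comp_contMDiffOn (contMDiffOn_extChartAt_symm c)).contDiffOn

omit [IsManifold I ∞ N] in
lemma ContMDiff.clm_comp_apply {V : Type*} [NormedAddCommGroup V] [NormedSpace ℝ V]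
    {u : N → E} (hu : ContMDiff I 𝓘(ℝ, E) ∞ u) (A : E →L[ℝ] V →L[ℝ] ℝ) :
    ContMDiff I 𝓘(ℝ, V →L[ℝ] ℝ) ∞ fun p => A (u p) :=
  ContMDiff.comp (I' := 𝓘(ℝ, E)) (g := A) A.isBoundedLinearMap.contDiff.contMDiff hu

/-- The inverse chart has invertible derivative within the range of the model, at boundary points
too, so critical points may be detected in any chart. -/
lemma mfderiv_eq_zero_iff_fderivWithin {f : N → G} (hf : ContMDiff I 𝓘(ℝ, G) ∞ f)
    {c q : N} (hq : q ∈ (extChartAt I c).source) :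
    mfderiv I 𝓘(ℝ, G) f q = 0 ↔ fderivWithin ℝ (fun x => f ((extChartAt I c).symm x))
      (extChartAt I c).target (extChartAt I c q) = 0 := by
  set e := extChartAt I c with he
  have key : ∀ x ∈ e.target, mfderiv I 𝓘(ℝ, G) f (e.symm x) = 0 ↔
      fderivWithin ℝ (fun x => f (e.symm x)) e.target x = 0 := by
    intro x hx
    have h1 : fderivWithin ℝ (fun x => f (e.symm x)) e.target x =
        fderivWithin ℝ (fun x => f (e.symm x)) (range I) x :=
      fderivWithin_congr_set (nhdsWithin_eq_iff_eventuallyEq.1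
        (nhdsWithin_extChartAt_target_eq_of_mem hx))
    have hU : UniqueMDiffWithinAt 𝓘(ℝ, E) (range I) x :=
      I.uniqueMDiffOn _ (extChartAt_target_subset_range c hx)
    have h2 := mfderiv_comp_mfderivWithin x (hf.mdifferentiableAt (x := e.symm x) (by simp))
      (mdifferentiableWithinAt_extChartAt_symm (I := I) hx) hU
    have h3 : mfderivWithin 𝓘(ℝ, E) 𝓘(ℝ, G) (f ∘ e.symm) (range I) x =
        fderivWithin ℝ (fun x => f (e.symm x)) (range I) x := mfderivWithin_eq_fderivWithin
    have hinv := isInvertible_mfderivWithin_extChartAt_symm (I := I) hx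
    rw [h1, ← h3, h2]
    constructor
    · intro h
      rw [h]
      exact ContinuousLinearMap.zero_comp _
    · intro h
      ext v
      obtain ⟨u, rfl⟩ := hinv.bijective.2 v
      exact DFunLike.congr_fun h u
  have := key (e q) (e.map_source hq)
  rwa [e.left_inv hq] at this

variable [FiniteDimensional ℝ E] [T2Space N]

/-- Finitely many charts cover a compact set, and there is a linear family of smooth functions
which near certain compact sets covering it contains the linear functions in these charts. -/
lemma exists_linear_family {X : Set N} (hX : IsCompact X) [LocallyCompactSpace N] :
    ∃ (ι : Finset N) (K : N → Set N) (w : N → (ι → (E →L[ℝ] ℝ)) →L[ℝ] ℝ)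
      (s : ι → (E →L[ℝ] ℝ) →L[ℝ] (ι → (E →L[ℝ] ℝ))),
      (∀ c ∈ ι, c ∈ X) ∧ (∀ c, IsCompact (K c) ∧ K c ⊆ (extChartAt I c).source) ∧
      (∀ p ∈ X, ∃ c ∈ ι, p ∈ K c) ∧ ContMDiff I 𝓘(ℝ, (ι → (E →L[ℝ] ℝ)) →L[ℝ] ℝ) ∞ w ∧
      ∀ c : ι, ∀ p ∈ K c, ∀ᶠ q in 𝓝 p, ∀ l : E →L[ℝ] ℝ,
        w q (s c l) = l (extChartAt I c.1 q) := by
  classical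
  let b : ∀ c : N, SmoothBumpFunction I c := fun c => Classical.arbitrary _
  have hK : ∀ c : N, ∃ K : Set N, IsCompact K ∧ K ∈ 𝓝 c ∧ K ⊆ (extChartAt I c).source ∧
      ∀ p ∈ K, ∀ᶠ q in 𝓝 p, b c q = 1 := by
    intro c
    obtain ⟨K, hKc, hKs, hK⟩ := local_compact_nhds (inter_mem (extChartAt_source_mem_nhds (I := I) c)
      (eventually_eventually_nhds.2 (b c).eventuallyEq_one))
    exact ⟨K, hK, hKc, hKs.trans inter_subset_left, fun p hp => (hKs hp).2⟩
  choose K hKc hKn hKs hKb using hK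
  -- The centres lie in `X`; when `X` is the boundary, this makes `boundaryChart` available at each
  -- of them.
  obtain ⟨ι, hιX, hιK⟩ := hX.elim_nhds_subcover K fun c _ => hKn c
  let u : N → N → E := fun c p => b c p • extChartAt I c p
  have hu : ∀ c, ContMDiff I 𝓘(ℝ, E) ∞ (u c) := fun c =>
    (b c).contMDiff_smul contMDiffOn_extChartAt
  -- A parameter is one functional `a c` for each chart, and `A c x a = a c x`. The family is the
  -- sum of these functionals applied to the cut-off charts.
  let A : ∀ c : ι, E →L[ℝ] (ι → (E →L[ℝ] ℝ)) →L[ℝ] ℝ := fun c =>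
    ((ContinuousLinearMap.compL ℝ (ι → (E →L[ℝ] ℝ)) (E →L[ℝ] ℝ) ℝ).flip
      (ContinuousLinearMap.proj c)).comp (ContinuousLinearMap.apply ℝ ℝ)
  refine ⟨ι, K, fun p => ∑ c : ι, A c (u c p),
    ContinuousLinearMap.single ℝ (fun _ : ι => E →L[ℝ] ℝ), hιX, fun c => ⟨hKc c, hKs c⟩, fun p hp => ?_,
    ?_, fun c p hp => ?_⟩
  · obtain ⟨c, hc, hpc⟩ := mem_iUnion₂.1 (hιK hp)
    exact ⟨c, hc, hpc⟩
  · refine contMDiff_finsetSum fun c _ => ?_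
    exact (hu c).clm_comp_apply (V := ι → (E →L[ℝ] ℝ)) (A c)
  · filter_upwards [hKb c p hp] with q hq l
    have hA : ∀ d : ι, ∀ x (a : ι → (E →L[ℝ] ℝ)), A d x a = a d x := fun d x a => rfl
    rw [sum_apply, ContinuousLinearMap.single_apply, Finset.sum_eq_single c]
    · rw [hA, Pi.single_eq_same]
      simp [u, hq]
    · intro d _ hd
      rw [hA, Pi.single_eq_of_ne hd]
      rfl
    · simp

/-- A compact manifold has a smooth function with finitely many critical points. -/
lemma exists_contMDiff_finite_critical [CompactSpace N] [LocallyCompactSpace N] :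
    ∃ f : N → ℝ, ContMDiff I 𝓘(ℝ, ℝ) ∞ f ∧ {p | mfderiv I 𝓘(ℝ, ℝ) f p = 0}.Finite := by
  classical
  obtain ⟨ι, K, w, s, -, hK, hcov, hw, hwK⟩ := exists_linear_family (I := I) (isCompact_univ (X := N))
  let _ : MeasurableSpace (ι → (E →L[ℝ] ℝ)) := borel _
  have : BorelSpace (ι → (E →L[ℝ] ℝ)) := ⟨rfl⟩
  have hae : ∀ᵐ a ∂(Measure.addHaar : Measure (ι → (E →L[ℝ] ℝ))), ∀ c : ι,
      ∀ x ∈ extChartAt I c.1 '' K c,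
      fderivWithin ℝ (fun y => 0 + w ((extChartAt I c.1).symm y) a) (extChartAt I c.1).target x = 0 →
      Injective (fderivWithin ℝ (fderivWithin ℝ (fun y => 0 + w ((extChartAt I c.1).symm y) a)
        (extChartAt I c.1).target) (extChartAt I c.1).target x) := by
    refine ae_all_iff.2 fun c => ?_
    refine ae_forall_critical_nondegenerate (g := fun _ => 0)
      (w := fun y => w ((extChartAt I c.1).symm y)) Measure.addHaar
      ((hK c).1.image_of_continuousOn ((continuousOn_extChartAt c.1).mono (hK c).2)) ?_
      (uniqueDiffOn_extChartAt_target c.1) contDiffOn_const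
      (hw.contDiffOn_comp_extChartAt_symm c.1)
      (s c) ?_
    · rintro _ ⟨p, hp, rfl⟩
      exact (extChartAt I c.1).map_source ((hK c).2 hp)
    · rintro _ ⟨p, hp, rfl⟩
      have hps := (hK c).2 hp
      have h1 := (continuousOn_extChartAt_symm (I := I) c.1 _ ((extChartAt I c.1).map_source hps))
      rw [ContinuousWithinAt, (extChartAt I c.1).left_inv hps] at h1
      filter_upwards [h1.eventually (hwK c p hp), self_mem_nhdsWithin] with y hy hyt l
      rw [hy l, (extChartAt I c.1).right_inv hyt]
  obtain ⟨a, ha⟩ := hae.exists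
  have hf : ContMDiff I 𝓘(ℝ, ℝ) ∞ fun p => w p a :=
    ((ContinuousLinearMap.apply ℝ ℝ a).contMDiff).comp hw
  refine ⟨fun p => w p a, hf, ?_⟩
  have hloc : ∀ p : N, {q | mfderiv I 𝓘(ℝ, ℝ) (fun p => w p a) q = 0 → q = p} ∈ 𝓝 p := by
    intro p
    obtain ⟨c, hc, hpc⟩ := hcov p (mem_univ p)
    have hps := (hK c).2 hpc
    set e := extChartAt I c with he
    set D := fderivWithin ℝ (fun y => w (e.symm y) a) e.target with hD
    have hgs : ContDiffOn ℝ ∞ (fun y => w (e.symm y) a) e.target :=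
      hf.contDiffOn_comp_extChartAt_symm c
    have hDs : ContDiffOn ℝ ∞ D e.target :=
      hgs.fderivWithin (uniqueDiffOn_extChartAt_target c) (by simp)
    have hxt := e.map_source hps
    -- A nondegenerate zero of `D` is isolated, since an injective derivative in finite dimension is
    -- bounded below; where `D` is nonzero, continuity suffices.
    have hev : ∀ᶠ x in 𝓝[e.target \ {e p}] (e p), D x ≠ 0 := by
      by_cases h0 : D (e p) = 0
      · have hinj : Injective (fderivWithin ℝ D e.target (e p)) := by
          have := ha ⟨c, hc⟩ (e p) ⟨p, hpc, rfl⟩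
          simp only [zero_add] at this
          exact this h0
        have hd : HasFDerivWithinAt D (fderivWithin ℝ D e.target (e p)) e.target (e p) :=
          (hDs.differentiableOn (by simp) _ hxt).hasFDerivWithinAt
        obtain ⟨C, -, hC⟩ := LinearMap.exists_antilipschitzWith
          (fderivWithin ℝ D e.target (e p) : E →ₗ[ℝ] (E →L[ℝ] ℝ)) (LinearMap.ker_eq_bot.2 hinj)
        exact hd.eventually_ne ⟨C, hC⟩
      · exact ((hDs.continuousOn _ hxt).eventually_ne h0).filter_mono
          (nhdsWithin_mono _ sdiff_subset)
    have hcont : Tendsto e (𝓝 p) (𝓝 (e p)) := continuousAt_extChartAt' hps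
    rw [eventually_nhdsWithin_iff] at hev
    filter_upwards [hcont.eventually hev, (isOpen_extChartAt_source c).mem_nhds hps] with q hq hqs hcrit
    by_contra hne
    refine hq ⟨e.map_source hqs, fun h => hne (e.injOn hqs hps h)⟩ ?_
    exact (mfderiv_eq_zero_iff_fderivWithin hf hqs).1 hcrit
  obtain ⟨t, ht⟩ := isCompact_univ.elim_nhds_subcover _ fun p (_ : p ∈ univ) => hloc p
  refine t.finite_toSet.subset fun q hq => ?_
  obtain ⟨p, hp, hqp⟩ := mem_iUnion₂.1 (ht.2 (mem_univ q))
  rw [hqp hq]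
  exact hp

omit [FiniteDimensional ℝ E] [T2Space N] in
/-- Submersions are stable under small perturbations in a linear family. -/
lemma eventually_forall_mfderiv_ne_zero [CompactSpace N]
    {V : Type*} [NormedAddCommGroup V] [NormedSpace ℝ V]
    {f : N → ℝ} (hf : ContMDiff I 𝓘(ℝ, ℝ) ∞ f) (hf0 : ∀ p, mfderiv I 𝓘(ℝ, ℝ) f p ≠ 0)
    {w : N → V →L[ℝ] ℝ} (hw : ContMDiff I 𝓘(ℝ, V →L[ℝ] ℝ) ∞ w) :
    ∀ᶠ a in 𝓝 (0 : V), ∀ p, mfderiv I 𝓘(ℝ, ℝ) (fun q => f q + w q a) p ≠ 0 := by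
  have hfw : ∀ a, ContMDiff I 𝓘(ℝ, ℝ) ∞ fun q => f q + w q a := fun a =>
    hf.add (((ContinuousLinearMap.apply ℝ ℝ a).contMDiff).comp hw)
  -- Tube lemma: by compactness of `N` it is enough that the derivative is nonzero for `(a, q)` near
  -- each `(0, p)`, which is joint continuity in a chart.
  have key := isCompact_univ.eventually_forall_of_forall_eventually (X := V) (Y := N) (x₀ := 0)
    (P := fun a p => mfderiv I 𝓘(ℝ, ℝ) (fun q => f q + w q a) p ≠ 0) fun p _ => ?_
  · filter_upwards [key] with a ha p using ha p (mem_univ p)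
  set e := extChartAt I p with he
  have hpt : e p ∈ e.target := mem_extChartAt_target p
  have hU := uniqueDiffOn_extChartAt_target (I := I) p
  have hg := hf.contDiffOn_comp_extChartAt_symm p
  have hw' := hw.contDiffOn_comp_extChartAt_symm p
  have hsrc := extChartAt_source_mem_nhds (I := I) p
  have htend : Tendsto e (𝓝 p) (𝓝[e.target] (e p)) :=
    tendsto_nhdsWithin_of_tendsto_nhds_of_eventually_within _ (continuousAt_extChartAt p)
      (by filter_upwards [hsrc] with q hq using e.map_source hq)
  have t1 : Tendsto (fun q => fderivWithin ℝ (fun x => f (e.symm x)) e.target (e q)) (𝓝 p)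
      (𝓝 (fderivWithin ℝ (fun x => f (e.symm x)) e.target (e p))) :=
    (hg.continuousOn_fderivWithin hU (by simp) _ hpt).tendsto.comp htend
  have t2 : Tendsto (fun q => fderivWithin ℝ (fun x => w (e.symm x)) e.target (e q)) (𝓝 p)
      (𝓝 (fderivWithin ℝ (fun x => w (e.symm x)) e.target (e p))) :=
    (hw'.continuousOn_fderivWithin hU (by simp) _ hpt).tendsto.comp htend
  have t3 : Tendsto (fun z : V × N => fderivWithin ℝ (fun x => f (e.symm x)) e.target (e z.2) +
      (fderivWithin ℝ (fun x => w (e.symm x)) e.target (e z.2)).flip z.1) (𝓝 (0, p))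
      (𝓝 (fderivWithin ℝ (fun x => f (e.symm x)) e.target (e p) +
        (fderivWithin ℝ (fun x => w (e.symm x)) e.target (e p)).flip 0)) := by
    have s2 : Tendsto (Prod.snd : V × N → N) (𝓝 (0, p)) (𝓝 p) := continuous_snd.tendsto _
    have s1 : Tendsto (Prod.fst : V × N → V) (𝓝 (0, p)) (𝓝 0) := continuous_fst.tendsto _
    refine (t1.comp s2).add ?_
    have s3 : Tendsto (fun z : V × N =>
        (fderivWithin ℝ (fun x => w (e.symm x)) e.target (e z.2)).flip) (𝓝 (0, p))
        (𝓝 (fderivWithin ℝ (fun x => w (e.symm x)) e.target (e p)).flip) :=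
      ((ContinuousLinearMap.flipₗᵢ ℝ E V ℝ).continuous.tendsto _).comp (t2.comp s2)
    exact (isBoundedBilinearMap_apply.continuous.tendsto _).comp (s3.prodMk_nhds s1)
  have hne : fderivWithin ℝ (fun x => f (e.symm x)) e.target (e p) +
      (fderivWithin ℝ (fun x => w (e.symm x)) e.target (e p)).flip 0 ≠ 0 := by
    rw [map_zero, add_zero]
    exact fun h => hf0 p ((mfderiv_eq_zero_iff_fderivWithin hf (mem_extChartAt_source p)).2 h)
  filter_upwards [t3.eventually_ne hne, (continuous_snd.tendsto (0, p)).eventually hsrc]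
    with z hz hzs hcrit
  refine hz ?_
  rw [mfderiv_eq_zero_iff_fderivWithin (hfw z.1) hzs] at hcrit
  refine Eq.trans ?_ hcrit
  exact (fderivWithin_add_clm_apply (hU _ (e.map_source hzs))
    (hg.differentiableOn (by simp) _ (e.map_source hzs))
    (hw'.differentiableOn (by simp) _ (e.map_source hzs)) z.1).symm

end Families

/-! ### Restriction of functions to the boundary, in boundary charts. -/

section BoundaryRestriction

/-- `boundaryProj` as a continuous linear map. -/
def boundaryProjCLM (m : ℕ) :
    EuclideanSpace ℝ (Fin (m + 1)) →L[ℝ] EuclideanSpace ℝ (Fin m) :=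
  LinearMap.toContinuousLinearMap
    { toFun := boundaryProj
      map_add' := fun x y => by ext i; simp [boundaryProj]
      map_smul' := fun a x => by ext i; simp [boundaryProj] }

variable {m : ℕ} {N : Type*} [TopologicalSpace N]
  [ChartedSpace (EuclideanHalfSpace (m + 1)) N] [IsManifold (𝓡∂ (m + 1)) ∞ N]
  {G : Type*} [NormedAddCommGroup G] [NormedSpace ℝ G]

lemma boundaryIncl_mem_extChartAt_target {c : (𝓡∂ (m + 1)).boundary N}
    {y : EuclideanSpace ℝ (Fin m)} (hy : y ∈ (boundaryChart c).target) :
    (boundaryIncl y).1 ∈ (extChartAt (𝓡∂ (m + 1)) c.1).target := by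
  have hs : (𝓡∂ (m + 1)).symm (boundaryIncl y).1 = boundaryIncl y :=
    (𝓡∂ (m + 1)).left_inv (boundaryIncl y)
  rw [extChartAt_target]
  refine ⟨?_, mem_range_self (boundaryIncl y)⟩
  rw [mem_preimage, hs]
  exact hy

lemma boundaryIncl_boundaryChart {c q : (𝓡∂ (m + 1)).boundary N}
    (hq : q ∈ (boundaryChart c).source) :
    (boundaryIncl (boundaryChart c q)).1 = extChartAt (𝓡∂ (m + 1)) c.1 q.1 :=
  congrArg Subtype.val (boundaryIncl_boundaryProj
    ((mem_boundary_iff_of_mem_atlas (chart_mem_atlas _ c.1) hq).1 q.2))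

/-- The restriction of a map to the boundary, in the boundary chart around `c`. -/
def boundaryExpr (c : (𝓡∂ (m + 1)).boundary N) (F : N → G) (y : EuclideanSpace ℝ (Fin m)) : G :=
  F ((extChartAt (𝓡∂ (m + 1)) c.1).symm (boundaryIncl y).1)

lemma contDiffOn_boundaryExpr (c : (𝓡∂ (m + 1)).boundary N) {F : N → G}
    (hF : ContMDiff (𝓡∂ (m + 1)) 𝓘(ℝ, G) ∞ F) :
    ContDiffOn ℝ ∞ (boundaryExpr c F) (boundaryChart c).target :=
  (hF.contDiffOn_comp_extChartAt_symm c.1).comp contDiff_boundaryIncl.contDiffOn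
    fun _ hy => boundaryIncl_mem_extChartAt_target hy

omit [NormedAddCommGroup G] [NormedSpace ℝ G] in
lemma boundaryExpr_boundaryChart {c q : (𝓡∂ (m + 1)).boundary N} (F : N → G)
    (hq : q ∈ (boundaryChart c).source) : boundaryExpr c F (boundaryChart c q) = F q.1 := by
  rw [boundaryExpr, boundaryIncl_boundaryChart hq, (extChartAt (𝓡∂ (m + 1)) c.1).left_inv]
  rw [extChartAt_source]
  exact hq

lemma contMDiffOn_boundaryChart (c : (𝓡∂ (m + 1)).boundary N) :
    ContMDiffOn (𝓡 m) (𝓡 m) ∞ (boundaryChart c) (boundaryChart c).source :=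
  contMDiffOn_of_mem_maximalAtlas
    (IsManifold.chart_mem_maximalAtlas (I := 𝓡 m) (n := ∞) (H := EuclideanSpace ℝ (Fin m)) c)

lemma contMDiffOn_boundaryChart_symm (c : (𝓡∂ (m + 1)).boundary N) :
    ContMDiffOn (𝓡 m) (𝓡 m) ∞ (boundaryChart c).symm (boundaryChart c).target :=
  contMDiffOn_symm_of_mem_maximalAtlas
    (IsManifold.chart_mem_maximalAtlas (I := 𝓡 m) (n := ∞) (H := EuclideanSpace ℝ (Fin m)) c)

/-- A boundary chart as a partial diffeomorphism. -/
def boundaryPartialDiffeomorph (c : (𝓡∂ (m + 1)).boundary N) :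
    PartialDiffeomorph (𝓡 m) (𝓡 m) ((𝓡∂ (m + 1)).boundary N) (EuclideanSpace ℝ (Fin m)) ∞ where
  toPartialEquiv := (boundaryChart c).toPartialEquiv
  open_source := (boundaryChart c).open_source
  open_target := (boundaryChart c).open_target
  contMDiffOn_toFun := contMDiffOn_boundaryChart c
  contMDiffOn_invFun := contMDiffOn_boundaryChart_symm c

lemma contMDiff_restrict_boundary {F : N → G} (hF : ContMDiff (𝓡∂ (m + 1)) 𝓘(ℝ, G) ∞ F) :
    ContMDiff (𝓡 m) 𝓘(ℝ, G) ∞ fun p : (𝓡∂ (m + 1)).boundary N => F p := by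
  intro p
  have hs : (boundaryChart p).source ∈ 𝓝 p :=
    (boundaryChart p).open_source.mem_nhds (mem_chart_source (EuclideanHalfSpace (m + 1)) p.1)
  have h1 : ContMDiffOn (𝓡 m) 𝓘(ℝ, G) ∞ (boundaryExpr p F ∘ boundaryChart p)
      (boundaryChart p).source :=
    (contDiffOn_boundaryExpr p hF).contMDiffOn.comp (contMDiffOn_boundaryChart p)
      fun q hq => (boundaryChart p).map_source hq
  refine (h1.contMDiffAt hs).congr_of_eventuallyEq ?_
  filter_upwards [hs] with q hq using (boundaryExpr_boundaryChart F hq).symm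

/-- A nonzero functional is onto `ℝ` and the derivative of a chart is onto, so a nonzero derivative
in the chart would make `p` a regular point. -/
lemma fderiv_boundaryExpr_eq_zero {F : N → ℝ} (hF : ContMDiff (𝓡∂ (m + 1)) 𝓘(ℝ, ℝ) ∞ F)
    {c p : (𝓡∂ (m + 1)).boundary N} (hp : p ∈ (boundaryChart c).source)
    (hsing : IsSingularPoint (𝓡 m) 𝓘(ℝ, ℝ) (fun p : (𝓡∂ (m + 1)).boundary N => F p) p) :
    fderiv ℝ (boundaryExpr c F) (boundaryChart c p) = 0 := by
  by_contra hne
  refine hsing ?_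
  have hev : (fun p : (𝓡∂ (m + 1)).boundary N => F p) =ᶠ[𝓝 p]
      boundaryExpr c F ∘ boundaryChart c := by
    filter_upwards [(boundaryChart c).open_source.mem_nhds hp] with q hq
      using (boundaryExpr_boundaryChart F hq).symm
  have hd : DifferentiableAt ℝ (boundaryExpr c F) (boundaryChart c p) :=
    ((contDiffOn_boundaryExpr c hF).contDiffAt ((boundaryChart c).open_target.mem_nhds
      ((boundaryChart c).map_source hp))).differentiableAt (by simp)
  have hmd : (boundaryChart c).MDifferentiable (𝓡 m) (𝓡 m) :=
    mdifferentiable_of_mem_atlas (I := 𝓡 m)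
      (chart_mem_atlas (EuclideanSpace ℝ (Fin m)) c)
  have hcomp := mfderiv_comp p (I' := 𝓡 m) hd.mdifferentiableAt (hmd.mdifferentiableAt hp)
  rw [hev.mfderiv_eq, hcomp, mfderiv_eq_fderiv]
  have hsurj : Surjective (fderiv ℝ (boundaryExpr c F) (boundaryChart c p)) :=
    LinearMap.surjective (f := (fderiv ℝ (boundaryExpr c F) (boundaryChart c p) :
      EuclideanSpace ℝ (Fin m) →ₗ[ℝ] ℝ)) fun h => hne (ContinuousLinearMap.coe_injective h)
  exact hsurj.comp (hmd.mfderiv_surjective hp)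

end BoundaryRestriction

/-! ### Fold normal form on the boundary and the final perturbation. -/

section DefiniteFolds

/-- The identification of `ℝ` with one-dimensional Euclidean space. -/
def lineEquiv : ℝ ≃L[ℝ] EuclideanSpace ℝ (Fin 1) :=
  (ContinuousLinearEquiv.funUnique (Fin 1) ℝ ℝ).symm.trans (EuclideanSpace.equiv (Fin 1) ℝ).symm

lemma lineEquiv_apply (t : ℝ) (i : Fin 1) : lineEquiv t i = t := rfl

/-- Translation followed by the identification with one-dimensional Euclidean space. -/
def lineChart (a : ℝ) :
    PartialDiffeomorph 𝓘(ℝ, ℝ) (𝓡 1) ℝ (EuclideanSpace ℝ (Fin 1)) ∞ where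
  toFun y := lineEquiv (y - a)
  invFun x := lineEquiv.symm x + a
  source := univ
  target := univ
  map_source' _ _ := mem_univ _
  map_target' _ _ := mem_univ _
  left_inv' y _ := by simp
  right_inv' x _ := by simp
  open_source := isOpen_univ
  open_target := isOpen_univ
  contMDiffOn_toFun := (lineEquiv.contDiff.comp
    (contDiff_id.sub contDiff_const)).contMDiff.contMDiffOn
  contMDiffOn_invFun := (lineEquiv.symm.contDiff.add contDiff_const).contMDiff.contMDiffOn

lemma lineChart_apply (a y : ℝ) : lineChart a y = lineEquiv (y - a) := rfl

/-- For `m = k = 1` the branch `j.val + 1 < k` never occurs and the sum has a single term. -/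
lemma definiteFoldForm_one (σ : ℤˣ) (x : EuclideanSpace ℝ (Fin 1)) :
    definiteFoldForm (le_refl 1) σ x = lineEquiv (((σ : ℤ) : ℝ) * x 0 ^ 2) := by
  ext i
  rw [lineEquiv_apply]
  simp [definiteFoldForm]

/-- Second derivative test form of the Morse lemma on one-dimensional Euclidean space. -/
lemma exists_partialDiffeomorph_eq_definiteFoldForm {h : EuclideanSpace ℝ (Fin 1) → ℝ}
    {Ω : Set (EuclideanSpace ℝ (Fin 1))} (hΩ : IsOpen Ω) (hh : ContDiffOn ℝ ∞ h Ω)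
    {y : EuclideanSpace ℝ (Fin 1)} (hy : y ∈ Ω) (h0 : fderiv ℝ h y = 0)
    (hinj : Injective (fderiv ℝ (fderiv ℝ h) y)) :
    ∃ (Φ : PartialDiffeomorph (𝓡 1) (𝓡 1) (EuclideanSpace ℝ (Fin 1))
        (EuclideanSpace ℝ (Fin 1)) ∞) (σ : ℤˣ),
      y ∈ Φ.source ∧ Φ y = 0 ∧
      ∀ x ∈ Φ.source, lineChart (h y) (h x) = definiteFoldForm (le_refl 1) σ (Φ x) := by
  obtain ⟨t, rfl⟩ := lineEquiv.surjective y
  let k : ℝ → ℝ := fun s => h (lineEquiv s)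
  have hU : IsOpen (lineEquiv ⁻¹' Ω) := hΩ.preimage lineEquiv.continuous
  have hk : ContDiffOn ℝ ∞ k (lineEquiv ⁻¹' Ω) :=
    hh.comp lineEquiv.contDiff.contDiffOn fun s hs => hs
  have hline : ∀ s, HasDerivAt lineEquiv (lineEquiv 1) s := fun s => by
    simpa using (lineEquiv : ℝ →L[ℝ] EuclideanSpace ℝ (Fin 1)).hasDerivAt (x := s)
  have hk1 : ∀ s ∈ lineEquiv ⁻¹' Ω, deriv k s = fderiv ℝ h (lineEquiv s) (lineEquiv 1) := by
    intro s hs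
    have hd : HasFDerivAt h (fderiv ℝ h (lineEquiv s)) (lineEquiv s) :=
      ((hh.contDiffAt (hΩ.mem_nhds hs)).differentiableAt (by simp)).hasFDerivAt
    exact (hd.comp_hasDerivAt s (hline s)).deriv
  have hk2 : deriv (deriv k) t = fderiv ℝ (fderiv ℝ h) (lineEquiv t) (lineEquiv 1) (lineEquiv 1) := by
    have hev : deriv k =ᶠ[𝓝 t] fun s => fderiv ℝ h (lineEquiv s) (lineEquiv 1) := by
      filter_upwards [hU.mem_nhds hy] with s hs using hk1 s hs
    have hd : HasFDerivAt (fderiv ℝ h) (fderiv ℝ (fderiv ℝ h) (lineEquiv t)) (lineEquiv t) :=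
      (((hh.fderiv_of_isOpen hΩ (m := ∞) (by simp)).contDiffAt
        (hΩ.mem_nhds hy)).differentiableAt (by simp)).hasFDerivAt
    rw [hev.deriv_eq]
    have := (hd.comp_hasDerivAt t (hline t)).clm_apply (hasDerivAt_const t (lineEquiv 1))
    simpa using this.deriv
  have hne : deriv (deriv k) t ≠ 0 := by
    rw [hk2]
    intro hz
    have hv : fderiv ℝ (fderiv ℝ h) (lineEquiv t) (lineEquiv 1) = 0 := by
      ext v
      obtain ⟨s, rfl⟩ := lineEquiv.surjective v
      have hs : lineEquiv s = s • lineEquiv 1 := by rw [← map_smul, smul_eq_mul, mul_one]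
      rw [hs, map_smul, hz, smul_zero]
      rfl
    have := hinj (hv.trans (map_zero _).symm)
    exact one_ne_zero (lineEquiv.injective (this.trans (map_zero _).symm))
  obtain ⟨Θ, σ, hΘ1, -, hΘ3, hΘ4⟩ := exists_partialDiffeomorph_eq_sq hU hy hk
    (by rw [hk1 t hy, h0]; rfl) hne
  refine ⟨((lineChart 0).symm.trans Θ).trans (lineChart 0), σ, ?_, ?_, ?_⟩
  · refine ⟨⟨mem_univ _, ?_⟩, mem_univ _⟩
    change lineEquiv.symm (lineEquiv t) + 0 ∈ Θ.source
    simpa using hΘ1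
  · change lineEquiv (Θ (lineEquiv.symm (lineEquiv t) + 0) - 0) = 0
    simp [hΘ3]
  · rintro x ⟨⟨-, hx⟩, -⟩
    obtain ⟨s, rfl⟩ := lineEquiv.surjective x
    have hx' : s ∈ Θ.source := by
      have : lineEquiv.symm (lineEquiv s) + 0 ∈ Θ.source := hx
      simpa using this
    have hform : (((lineChart 0).symm.trans Θ).trans (lineChart 0)) (lineEquiv s) =
        lineEquiv (Θ s) := by
      change lineEquiv (Θ (lineEquiv.symm (lineEquiv s) + 0) - 0) = _
      simp
    rw [hform, definiteFoldForm_one, lineEquiv_apply, lineChart_apply]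
    congr 1
    have := hΘ4 s hx'
    simp only [k] at this
    rw [this]
    ring

variable {N : Type*} [TopologicalSpace N] [ChartedSpace (EuclideanHalfSpace 2) N]
  [IsManifold (𝓡∂ 2) ∞ N]

/-- The source coordinate is the boundary chart followed by the Morse coordinate; the target
coordinate is translation by `F p`. -/
lemma isDefiniteFoldPoint_of_nondegenerate {F : N → ℝ} (hF : ContMDiff (𝓡∂ 2) 𝓘(ℝ, ℝ) ∞ F)
    {c p : (𝓡∂ 2).boundary N} (hp : p ∈ (boundaryChart (m := 1) c).source)
    (hsing : IsSingularPoint (𝓡 1) 𝓘(ℝ, ℝ) (fun p : (𝓡∂ 2).boundary N => F p) p)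
    (hnd : fderiv ℝ (boundaryExpr (m := 1) c F) (boundaryChart (m := 1) c p) = 0 →
      Injective (fderiv ℝ (fderiv ℝ (boundaryExpr (m := 1) c F)) (boundaryChart (m := 1) c p))) :
    IsDefiniteFoldPoint (𝓡 1) 𝓘(ℝ, ℝ) (le_refl 1) (fun p : (𝓡∂ 2).boundary N => F p) p := by
  have h0 := fderiv_boundaryExpr_eq_zero (m := 1) hF hp hsing
  obtain ⟨Φ, σ, hΦ1, hΦ2, hΦ3⟩ := exists_partialDiffeomorph_eq_definiteFoldForm
    (boundaryChart (m := 1) c).open_target (contDiffOn_boundaryExpr (m := 1) c hF)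
    ((boundaryChart (m := 1) c).map_source hp) h0 (hnd h0)
  refine ⟨hsing, (boundaryPartialDiffeomorph (m := 1) c).trans Φ, lineChart (F p), σ,
    ⟨hp, hΦ1⟩, hΦ2, mem_univ _, ?_, ?_⟩
  · rw [lineChart_apply, sub_self, map_zero]
  · rintro x ⟨hx1, hx2⟩
    refine ⟨mem_univ _, ?_⟩
    have := hΦ3 _ hx2
    change lineChart _ (boundaryExpr (m := 1) c F (boundaryChart (m := 1) c x)) = _ at this
    rw [boundaryExpr_boundaryChart (m := 1) F hx1, boundaryExpr_boundaryChart (m := 1) F hp] at this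
    exact this

variable [T2Space N] [CompactSpace N]

/-- A submersion of a compact surface can be perturbed to one which is Morse on the boundary. -/
lemma exists_isSubmersionWithDefiniteFolds {f : N → ℝ} (hf : ContMDiff (𝓡∂ 2) 𝓘(ℝ, ℝ) ∞ f)
    (hf0 : ∀ p, mfderiv (𝓡∂ 2) 𝓘(ℝ, ℝ) f p ≠ 0) :
    ∃ F : N → ℝ, IsSubmersionWithDefiniteFolds (m := 1) (k := 1) 𝓘(ℝ, ℝ) le_rfl F := by
  have hbc : IsCompact ((𝓡∂ 2).boundary N) :=
    (ModelWithCorners.isClosed_boundary (I := 𝓡∂ 2) (M := N) (n := ∞) (by simp)).isCompact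
  obtain ⟨ι, K, w, s, hι, hK, hcov, hw, hwK⟩ := exists_linear_family (I := 𝓡∂ 2) hbc
  let _ : MeasurableSpace (ι → (EuclideanSpace ℝ (Fin 2) →L[ℝ] ℝ)) := borel _
  have : BorelSpace (ι → (EuclideanSpace ℝ (Fin 2) →L[ℝ] ℝ)) := ⟨rfl⟩
  let b : ι → (𝓡∂ 2).boundary N := fun c => ⟨c.1, hι c.1 c.2⟩
  have hae : ∀ᵐ a ∂(Measure.addHaar : Measure (ι → (EuclideanSpace ℝ (Fin 2) →L[ℝ] ℝ))),
      ∀ c : ι, ∀ x ∈ boundaryChart (m := 1) (b c) '' (Subtype.val ⁻¹' K c),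
      fderivWithin ℝ (fun y => boundaryExpr (m := 1) (b c) f y + boundaryExpr (m := 1) (b c) w y a)
        (boundaryChart (m := 1) (b c)).target x = 0 →
      Injective (fderivWithin ℝ (fderivWithin ℝ (fun y => boundaryExpr (m := 1) (b c) f y +
        boundaryExpr (m := 1) (b c) w y a) (boundaryChart (m := 1) (b c)).target)
        (boundaryChart (m := 1) (b c)).target x) := by
    refine ae_all_iff.2 fun c => ?_
    have hKs : Subtype.val ⁻¹' K c ⊆ (boundaryChart (m := 1) (b c)).source := fun q hq => by
      have := (hK c).2 hq
      rwa [extChartAt_source] at this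
    refine ae_forall_critical_nondegenerate Measure.addHaar ?_ ?_
      (boundaryChart (m := 1) (b c)).open_target.uniqueDiffOn
      (contDiffOn_boundaryExpr (m := 1) _ hf) (contDiffOn_boundaryExpr (m := 1) _ hw)
      -- A functional `l` on the boundary line is extended to the plane as `l ∘ boundaryProj`. The
      -- family contains this extension near `K c`, and it restricts to `l` on the boundary.
      ((s c).comp ((ContinuousLinearMap.compL ℝ (EuclideanSpace ℝ (Fin 2))
        (EuclideanSpace ℝ (Fin 1)) ℝ).flip (boundaryProjCLM 1))) ?_
    · refine IsCompact.image_of_continuousOn ?_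
        ((boundaryChart (m := 1) (b c)).continuousOn.mono hKs)
      rw [Topology.IsEmbedding.subtypeVal.isCompact_iff, Subtype.image_preimage_coe]
      exact hbc.inter_right (hK c).1.isClosed
    · rintro _ ⟨q, hq, rfl⟩
      exact (boundaryChart (m := 1) (b c)).map_source (hKs hq)
    · rintro _ ⟨q, hq, rfl⟩
      have hqt := (boundaryChart (m := 1) (b c)).map_source (hKs hq)
      have hcont : ContinuousOn (fun y : EuclideanSpace ℝ (Fin 1) =>
          (extChartAt (𝓡∂ 2) c.1).symm (boundaryIncl y).1)
          (boundaryChart (m := 1) (b c)).target :=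
        (continuousOn_extChartAt_symm c.1).comp contDiff_boundaryIncl.continuous.continuousOn
          fun y hy => boundaryIncl_mem_extChartAt_target (m := 1) hy
      have hval : (extChartAt (𝓡∂ 2) c.1).symm
          (boundaryIncl (boundaryChart (m := 1) (b c) q)).1 = q.1 :=
        boundaryExpr_boundaryChart (m := 1) (c := b c) (fun p : N => p) (hKs hq)
      have h1 := hcont _ hqt
      rw [ContinuousWithinAt, hval] at h1
      filter_upwards [h1.eventually (hwK c q.1 hq), self_mem_nhdsWithin] with y hy hyt l
      have h2 := hy (l.comp (boundaryProjCLM 1))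
      rw [(extChartAt (𝓡∂ 2) c.1).right_inv
        (boundaryIncl_mem_extChartAt_target (m := 1) (c := b c) hyt)] at h2
      refine h2.trans ?_
      change l (boundaryProj (boundaryIncl y).1) = l y
      rw [boundaryProj_boundaryIncl]
  -- A set of full Haar measure is dense, so some parameter close enough to `0` to keep the
  -- submersion also gives nondegeneracy on the boundary.
  obtain ⟨a, hmorse, hsub⟩ := (Measure.dense_of_ae hae).inter_nhds_nonempty
    (eventually_forall_mfderiv_ne_zero hf hf0 hw)
  have hF : ContMDiff (𝓡∂ 2) 𝓘(ℝ, ℝ) ∞ fun q => f q + w q a :=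
    hf.add (((ContinuousLinearMap.apply ℝ ℝ a).contMDiff).comp hw)
  refine ⟨fun q => f q + w q a, ⟨hF, fun p hp => hp ?_⟩,
    contMDiff_restrict_boundary (m := 1) hF, fun p hp => ?_⟩
  · let D : EuclideanSpace ℝ (Fin 2) →L[ℝ] ℝ := mfderiv (𝓡∂ 2) 𝓘(ℝ, ℝ) (fun q => f q + w q a) p
    exact LinearMap.surjective (f := D.toLinearMap) fun h =>
      hsub p (ContinuousLinearMap.coe_injective h)
  · obtain ⟨c, hc, hpc⟩ := hcov p.1 p.2
    have hps : p ∈ (boundaryChart (m := 1) (b ⟨c, hc⟩)).source := by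
      have := (hK c).2 hpc
      rwa [extChartAt_source] at this
    refine isDefiniteFoldPoint_of_nondegenerate (c := b ⟨c, hc⟩) hF hps hp fun h0 => ?_
    have hopen := (boundaryChart (m := 1) (b ⟨c, hc⟩)).open_target
    have hpt := (boundaryChart (m := 1) (b ⟨c, hc⟩)).map_source hps
    have h1 := hmorse ⟨c, hc⟩ _ ⟨p, hpc, rfl⟩
    rw [fderivWithin_of_isOpen hopen hpt, fderivWithin_of_isOpen hopen hpt] at h1
    have h2 := h1 h0
    have hev : fderivWithin ℝ (fun y => boundaryExpr (m := 1) (b ⟨c, hc⟩) f y +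
        boundaryExpr (m := 1) (b ⟨c, hc⟩) w y a) (boundaryChart (m := 1) (b ⟨c, hc⟩)).target
        =ᶠ[𝓝 (boundaryChart (m := 1) (b ⟨c, hc⟩) p)] fderiv ℝ (boundaryExpr (m := 1) (b ⟨c, hc⟩)
          fun q => f q + w q a) := by
      filter_upwards [hopen.mem_nhds hpt] with y hy using fderivWithin_of_isOpen hopen hy
    rwa [hev.fderiv_eq] at h2

end DefiniteFolds

end

theorem proposition3p1 (N : Type*) [TopologicalSpace N] [T2Space N] [CompactSpace N]
    [ConnectedSpace N] [ChartedSpace (EuclideanHalfSpace 2) N] [IsManifold (𝓡∂ 2) ∞ N]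
    (hN : ((𝓡∂ 2).boundary N).Nonempty) :
    ∃ F : N → ℝ, IsSubmersionWithDefiniteFolds (m := 1) (k := 1) 𝓘(ℝ, ℝ) le_rfl F := by
  obtain ⟨f, hf, hfin⟩ := exists_contMDiff_finite_critical (I := 𝓡∂ 2) (N := N)
  obtain ⟨g, hg, hg0⟩ := exists_submersion_of_finite_critical (m := 1) hN hf hfin
  exact exists_isSubmersionWithDefiniteFolds hg hg0
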